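/- **Setting (adversarial Bandits with Knapsacks).** There are $n\ge 1$ actions, $T$ rounds, a monotone norm $\|\cdot\|$ on $\mathbb R^d$, $d\ge 1$ (monotone: $\|u\|\ge\|v\|$ whenever $u\ge v\ge 0$), and a budget $B$. An adversary fixes in advance rewards $r^{(t)}\in[0,1]^n$ and cost matrices $C^{(t)}\in[0,1]^{d\times n}$ for $t=1,\dots,T$; one action, the null action, always has reward $0$ and cost vector $\mathbf 0$. In round $t$ the algorithm picks an action $a_t$, possibly at random, and then observes only the reward $r^{(t)}_{a_t}$ and the cost vector $C^{(t)}e_{a_t}$. It has to keep $\big\|\sum_t C^{(t)}e_{a_t}\big\|<B$, and its reward is $\sum_t r^{(t)}_{a_t}$. The benchmark is $$\mathrm{OPT}=\sup\Big\{\sum_{t=1}^T\langle r^{(t)},x\rangle \;:\; x\in[0,1]^n,\ \sum_i x_i\le 1,\ \Big\|\sum_{t=1}^T C^{(t)}x\Big\|\le B\Big\}.$$ **Gradient stability.** The norm admits a $\delta$-gradient-stable approximation with error $(\alpha,\gamma)$ if for every $\epsilon>0$ there is a monotone, subadditive, convex, differentiable function $\Psi_\epsilon:\mathbb R^d_+\to\mathbb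 R$ such that, for all $x,y\in\mathbb R^d_+$, coordinate-wise $\nabla\Psi_\epsilon(x+y)\ge \exp(-\epsilon\|y\|-\delta)\,\nabla\Psi_\epsilon(x)$, and $\|x\|\le\Psi_\epsilon(x)\le\alpha\|x\|+\gamma/\epsilon$. **Theorem.** There are a randomized algorithm and absolute constants $c,K>0$ such that the following holds. Suppose that $\|\cdot\|$ admits a $\frac14$-gradient-stable approximation $(\Psi_\epsilon)_{\epsilon>0}$ with error $(\alpha,\gamma)$, that $B\ge 4(\alpha+\gamma)\|\mathbf 1\|$, and that $p\in(0,1]$. The algorithm takes $n,d,T,B,p,\alpha,\gamma$ and the value $\mathrm{OPT}$ as input and has access to the norm only through an oracle for the gradients $\nabla\Psi_\epsilon$. It always respects the budget, and with probability at least $1-p$ its reward is at least $$c\cdot\frac{\mathrm{OPT}}{\alpha+\gamma}\;-\;K\Big(1+\frac{\mathrm{OPT}\cdot\|\mathbf 1\|}{(\alpha+\gamma)\,B}\Big)\sqrt{T\,n\,\log(n/p)} .$$ Moreover, the algorithm is efficient: in the real-arithmetic model (unit-cost arithmetic, $\exp$, $\log$ and comparisons on reals, one uniform random number in $[0,1]$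 per round, $1+d$ steps per gradient-oracle call), its total running time is bounded by a polynomial in $n,d,T$. -/

import Mathlib

open MeasureTheory

noncomputable section

/-! ### Gradient-stable approximations of norms -/

/-- The non-negative orthant of `ℝ^d`. -/
def orthant (d : ℕ) : Set (Fin d → ℝ) := {x | ∀ i, 0 ≤ x i}

/-- The gradient of a function on the non-negative orthant (one-sided on the boundary; the orthant
is a convex set with non-empty interior, so the derivative within it is unique). -/
def orthantGrad {d : ℕ} (Ψ : (Fin d → ℝ) → ℝ) (x : Fin d → ℝ) : Fin d → ℝ :=
  fun i => fderivWithin ℝ Ψ (orthant d) x (Pi.single i 1)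

/-- `Ψ` is a `δ`-gradient-stable approximation of the norm `N` at scale `ε` with multiplicative
error `α` and additive error `γ`. -/
structure IsGradStableApprox {d : ℕ} (N : Seminorm ℝ (Fin d → ℝ)) (δ α γ ε : ℝ)
    (Ψ : (Fin d → ℝ) → ℝ) : Prop where
  monotone : ∀ x ∈ orthant d, ∀ y ∈ orthant d, x ≤ y → Ψ x ≤ Ψ y
  subadditive : ∀ x ∈ orthant d, ∀ y ∈ orthant d, Ψ (x + y) ≤ Ψ x + Ψ y
  convex : ConvexOn ℝ (orthant d) Ψ
  differentiable : DifferentiableOn ℝ Ψ (orthant d)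
  gradient_stable : ∀ x ∈ orthant d, ∀ y ∈ orthant d, ∀ i,
    Real.exp (-ε * N y - δ) * orthantGrad Ψ x i ≤ orthantGrad Ψ (x + y) i
  norm_le : ∀ x ∈ orthant d, N x ≤ Ψ x
  le_norm : ∀ x ∈ orthant d, Ψ x ≤ α * N x + γ / ε

/-! ### The benchmark of Bandits with Knapsacks -/

/-- The best total reward of a fixed fractional selection `x` of the actions (`x ≥ 0`,
`∑ i, x i ≤ 1`), played in each of the rounds `0, …, T - 1`, whose total cost has norm at most
`B`. -/
def optBwK {n d : ℕ} (N : Seminorm ℝ (Fin d → ℝ)) (B : ℝ) (T : ℕ)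
    (r : ℕ → Fin n → ℝ) (C : ℕ → Matrix (Fin d) (Fin n) ℝ) : ℝ :=
  sSup {v : ℝ | ∃ x : Fin n → ℝ, (∀ i, 0 ≤ x i) ∧ ∑ i, x i ≤ 1 ∧
    N (∑ t ∈ Finset.range T, (C t).mulVec x) ≤ B ∧
    v = ∑ t ∈ Finset.range T, ∑ i, r t i * x i}

/-! ### Programs over the reals with a gradient oracle, and their running time -/

/-- The memory: registers holding natural numbers, and arrays of real numbers. -/
structure Mem where
  nat : ℕ → ℕ
  real : ℕ → ℕ → ℝ

/-- Write a natural number into register `i`. -/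
def Mem.setNat (m : Mem) (i v : ℕ) : Mem :=
  { m with nat := Function.update m.nat i v }

/-- Write a real number into entry `j` of array `a`. -/
def Mem.setReal (m : Mem) (a j : ℕ) (v : ℝ) : Mem :=
  { m with real := Function.update m.real a (Function.update (m.real a) j v) }

/-- Write the vector `v` into the first `d` entries of array `a`. -/
def Mem.setVec {d : ℕ} (m : Mem) (a : ℕ) (v : Fin d → ℝ) : Mem :=
  { m with
    real := Function.update m.real a (fun j => if h : j < d then v ⟨j, h⟩ else m.real a j) }

/-- A memory cell `(a, i)`: the entry of array `a` whose index is stored in register `i`. -/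
structure Cell where
  arr : ℕ
  idx : ℕ

/-- The content of a cell. -/
def Mem.get (m : Mem) (x : Cell) : ℝ := m.real x.arr (m.nat x.idx)

/-- Overwrite a cell. -/
def Mem.set (m : Mem) (x : Cell) (v : ℝ) : Mem := m.setReal x.arr (m.nat x.idx) v

/-- Arithmetic operations on two reals. -/
inductive BinOp
  | add
  | sub
  | mul
  | div

/-- The value of an arithmetic operation. -/
def BinOp.eval : BinOp → ℝ → ℝ → ℝ
  | .add, x, y => x + y
  | .sub, x, y => x - y
  | .mul, x, y => x * y
  | .div, x, y => x / y

/-- Structured programs over the reals: arithmetic, exponential, logarithm, comparisons, bounded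
loops, and calls to a gradient oracle. The only constants are natural numbers. -/
inductive Prog
  /-- `reg i := k` -/
  | natConst (i k : ℕ)
  /-- `reg i := reg j + reg k` -/
  | natAdd (i j k : ℕ)
  /-- `x := reg i` -/
  | cast (x : Cell) (i : ℕ)
  /-- `z := x op y` -/
  | arith (op : BinOp) (z x y : Cell)
  /-- `y := exp x` -/
  | exp (y x : Cell)
  /-- `y := log x` -/
  | log (y x : Cell)
  /-- the first `d` entries of array `b` `:=` the gradient, at scale `e`, at the vector in the first
  `d` entries of array `a` -/
  | grad (b a : ℕ) (e : Cell)
  /-- `P; Q` -/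
  | seq (P Q : Prog)
  /-- if `x ≤ y` then `P` else `Q` -/
  | ifLe (x y : Cell) (P Q : Prog)
  /-- if `reg i ≤ reg j` then `P` else `Q` -/
  | ifNatLe (i j : ℕ) (P Q : Prog)
  /-- for `reg i = 0, …, reg j - 1` do `P` -/
  | forLoop (i j : ℕ) (P : Prog)

open Classical in
/-- Execution of a program with gradient oracle `O` (arguments: scale and point): the resulting
memory and the number of steps. Every instruction, test and loop iteration costs one step, and a
call of the oracle costs `1 + d` steps. -/
def Prog.exec {d : ℕ} (O : ℝ → (Fin d → ℝ) → Fin d → ℝ) : Prog → Mem → Mem × ℕ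
  | .natConst i k, m => (m.setNat i k, 1)
  | .natAdd i j k, m => (m.setNat i (m.nat j + m.nat k), 1)
  | .cast x i, m => (m.set x (m.nat i), 1)
  | .arith op z x y, m => (m.set z (op.eval (m.get x) (m.get y)), 1)
  | .exp y x, m => (m.set y (Real.exp (m.get x)), 1)
  | .log y x, m => (m.set y (Real.log (m.get x)), 1)
  | .grad b a e, m => (m.setVec b (O (m.get e) (fun j => m.real a j)), 1 + d)
  | .seq P Q, m =>
      let s := P.exec O m
      let s' := Q.exec O s.1
      (s'.1, s.2 + s'.2)
  | .ifLe x y P Q, m =>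
      let s := if m.get x ≤ m.get y then P.exec O m else Q.exec O m
      (s.1, 1 + s.2)
  | .ifNatLe i j P Q, m =>
      let s := if m.nat i ≤ m.nat j then P.exec O m else Q.exec O m
      (s.1, 1 + s.2)
  | .forLoop i j P, m =>
      Nat.rec (m, 1)
        (fun k s =>
          let s' := P.exec O (s.1.setNat i k)
          (s'.1, s.2 + 1 + s'.2))
        (m.nat j)

/-! ### Playing Bandits with Knapsacks -/

/-- A bandit algorithm: a program run once before the first round, and a program run at the
beginning of each round, which selects the action of the round. -/
structure BanditAlg where
  setup : Prog
  step : Prog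

/-- The initial memory. Registers `0, 1, 2` hold `n, d, T`; the entries `0, …, 4` of array `0` hold
`B, p, α, γ, OPT`; everything else is `0`. -/
def initMem (n d T : ℕ) (B p α γ opt : ℝ) : Mem where
  nat := fun i => if i = 0 then n else if i = 1 then d else if i = 2 then T else 0
  real := fun a j => if a = 0 then
      (if j = 0 then B else if j = 1 then p else if j = 2 then α else if j = 3 then γ
        else if j = 4 then opt else 0)
    else 0

/-- The play so far: the memory of the algorithm, its number of steps, and the total cost vector and
total reward of the actions played. -/
structure PlayState (d : ℕ) where
  mem : Mem
  time : ℕ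
  cost : Fin d → ℝ
  reward : ℝ

/-- The action selected in the memory `m`, stored in register `3`; an invalid number stands for the
null action `0`. -/
def chosenAction (n : ℕ) [NeZero n] (m : Mem) : Fin n :=
  if h : m.nat 3 < n then ⟨m.nat 3, h⟩ else 0

/-- One round with rewards `r` and cost matrix `C`: a fresh random number `u` is put into entry `0`
of array `1`, the algorithm is run and its action `a` is played. Then the algorithm receives the
bandit feedback: the reward `r a` (entry `1` of array `1`) and the cost vector, the column `a` of
`C` (array `2`), and nothing else. -/
def playRound {n d : ℕ} [NeZero n] (A : BanditAlg) (O : ℝ → (Fin d → ℝ) → Fin d → ℝ)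
    (r : Fin n → ℝ) (C : Matrix (Fin d) (Fin n) ℝ) (u : ℝ) (s : PlayState d) : PlayState d :=
  let e := A.step.exec O (s.mem.setReal 1 0 u)
  let a := chosenAction n e.1
  { mem := (e.1.setReal 1 1 (r a)).setVec 2 (fun j => C j a)
    time := s.time + e.2
    cost := s.cost + fun j => C j a
    reward := s.reward + r a }

/-- The state after the first `t` rounds, for the sequence `ω` of random numbers, when the algorithm
is started in the memory `m₀`. -/
def play {n d : ℕ} [NeZero n] (A : BanditAlg) (O : ℝ → (Fin d → ℝ) → Fin d → ℝ) (m₀ : Mem)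
    (r : ℕ → Fin n → ℝ) (C : ℕ → Matrix (Fin d) (Fin n) ℝ) (ω : ℕ → unitInterval) :
    ℕ → PlayState d
  | 0 =>
      let e := A.setup.exec O m₀
      { mem := e.1, time := e.2, cost := 0, reward := 0 }
  | t + 1 => playRound A O (r t) (C t) (ω t) (play A O m₀ r C ω t)

/-- The law of a sequence of independent uniform random numbers in `[0, 1]`. -/
def seedMeasure : Measure (ℕ → unitInterval) :=
  Measure.infinitePi (fun _ => (volume : Measure unitInterval))

end

/-!
The algorithm runs multiplicative weights on the arms, where an arm is worth its reward minus a
price: `λ` times the pairing of its cost vector with the gradient of the potential `Ψ_ε`, for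
`ε` of order `(α + γ) / B` and `λ` of order `OPT / ((α + γ) B)`. It stops when an upper bound on the
potential, computed from gradients by convexity, exceeds `B / 2`; one more round adds at most
`‖1‖ ≤ B / 4`, so the budget is respected (`potential_le_spent`).

The regret term of the theorem is only an indication of when the bound is vacuous. As rewards are
non-negative, one may assume that the bound is positive, and then `OPT` and `B` are large compared
to `√(T n log (n / p))` (`LargeRegime`). In this regime the algorithm gets a constant fraction of
`OPT / (α + γ)` without any further loss, so that it can afford constant factors everywhere:

* It plays an arm only with a fraction `mix`, of order `1 / (α + γ)`, of the probability that
  multiplicative weights assigns to it, and the null action otherwise. It competes with `mix` times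
  the optimal mixture, which has that much less cost.
* Arms whose weight is below a cutoff are not played, and scored as if they had reward `1` and no
  cost. This bounds the importance weights, needs no exploration, and costs `mix * n * cutoff` per
  round. Scores then change by small factors, and the multiplicative-weights inequality holds with
  the total rewards and prices themselves in place of second-order terms
  (`sum_exp_nextState_le`, `sum_exp_logw_le`).
* The exponential of the amount by which the score of an arm falls short of a fraction of its true
  value is a supermartingale (`lintegral_exp_shortfall_le`), so Markov's inequality and a union bound
  over the arms give the high-probability statement (`seedMeasure_shortfall_le`). Its expectation is
  computed along histories of actions, a countable type, so the gradients need not be measurable.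

It remains to bound the price of the optimal mixture. The load of the mixture is added to the load of
the algorithm inside the potential. Its norm is of order `1 / ε`, so by stability this changes the
gradients by little more than `exp (1 / 4)`, and by convexity the potential at the sum of both loads
increases by at least a constant fraction of both prices (`mixture_price_le`), while by
subadditivity it is at most the potential of the algorithm plus that of the mixture. To have gradients
that are fixed before the action of a round but dominate those after it, prices are taken at the
load plus the all-ones vector (`spent_le_exp_mul_paid`). In total, stability enters with the factor
`exp (1 / 2) < 2`. Hence the price of the mixture is at most a fraction less than `1` of the price the
algorithm pays, plus a small multiple of `B`. If the algorithm never stops, it competes with all of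
`OPT`; if it stops, it has paid a constant fraction of `B`, worth `λ B`. Both give reward of order
`OPT / (α + γ)` (`gain_ge`).

The program keeps the logarithms of the weights and processes the feedback of a round at the
beginning of the next one; `represents_round` shows that it follows the algorithm, and
`Prog.time_le_timeBound` bounds its running time from the syntax.
-/

noncomputable section

/-! ### Random histories -/

/-- The list of the actions of the first `t` rounds, latest first, when the action of a round is a
function `act` of the earlier actions and of the random number of the round. -/
def history (act : List ℕ → unitInterval → ℕ) (ω : ℕ → unitInterval) : ℕ → List ℕ
  | 0 => []
  | t + 1 => act (history act ω t) (ω t) :: history act ω t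

theorem history_length (act : List ℕ → unitInterval → ℕ) (ω : ℕ → unitInterval) (t : ℕ) :
    (history act ω t).length = t := by
  induction t with
  | zero => rfl
  | succ t ih => simp [history, ih]

/-- The first `t` actions are determined by the first `t` random numbers. -/
theorem history_measurable (act : List ℕ → unitInterval → ℕ)
    (hact : ∀ h a, MeasurableSet {u | act h u = a}) (t : ℕ) :
    @Measurable _ _ (⨆ i ∈ Set.Iio t,
      MeasurableSpace.comap (fun ω : ℕ → unitInterval => ω i) inferInstance) ⊤
      (fun ω => history act ω t) := by
  induction t with
  | zero => exact @measurable_const _ _ ⊤ _ _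
  | succ t ih =>
    set m := ⨆ i ∈ Set.Iio (t + 1),
      MeasurableSpace.comap (fun ω : ℕ → unitInterval => ω i) inferInstance with hm
    let _ : MeasurableSpace (List ℕ) := ⊤
    have hle : (⨆ i ∈ Set.Iio t,
        MeasurableSpace.comap (fun ω : ℕ → unitInterval => ω i) inferInstance) ≤ m :=
      biSup_mono fun i hi => lt_trans hi (Nat.lt_succ_self t)
    have h1 : Measurable[m] (fun ω => history act ω t) := ih.mono hle le_rfl
    have h2 : Measurable[m] (fun ω : ℕ → unitInterval => ω t) := by
      have : MeasurableSpace.comap (fun ω : ℕ → unitInterval => ω t) inferInstance ≤ m :=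
        le_biSup (fun i => MeasurableSpace.comap (fun ω : ℕ → unitInterval => ω i) inferInstance)
          (Set.mem_Iio.2 (Nat.lt_succ_self t))
      exact (comap_measurable _).mono this le_rfl
    have h3 : Measurable (fun x : List ℕ × unitInterval => act x.1 x.2 :: x.1) := by
      refine measurable_from_prod_countable_right fun h => ?_
      have : Measurable (act h) := measurable_to_countable' fun a => hact h a
      exact (measurable_from_top (f := fun a : ℕ => a :: h)).comp this
    exact h3.comp (h1.prodMk h2)

/-- If a function of the history does not increase in expectation from one round to the next, then
its expectation stays below its initial value. -/
theorem lintegral_history_le (act : List ℕ → unitInterval → ℕ)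
    (hact : ∀ h a, MeasurableSet {u | act h u = a}) (F : List ℕ → ENNReal) (T : ℕ)
    (hstep : ∀ h : List ℕ, h.length < T → ∫⁻ u, F (act h u :: h) ≤ F h) :
    ∀ t ≤ T, ∫⁻ ω, F (history act ω t) ∂seedMeasure ≤ F [] := by
  intro t
  induction t with
  | zero =>
    intro _
    have : IsProbabilityMeasure seedMeasure := by unfold seedMeasure; infer_instance
    simp [history]
  | succ t ih =>
    intro ht
    have : IsProbabilityMeasure seedMeasure := by unfold seedMeasure; infer_instance
    let _ : MeasurableSpace (List ℕ) := ⊤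
    have hle : ∀ i : ℕ, MeasurableSpace.comap (fun ω : ℕ → unitInterval => ω i) inferInstance
        ≤ (inferInstance : MeasurableSpace (ℕ → unitInterval)) :=
      fun i => (measurable_pi_apply i).comap_le
    have hmeas : Measurable (fun ω => history act ω t) :=
      (history_measurable act hact t).mono (iSup₂_le fun i _ => hle i) le_rfl
    have hind : ProbabilityTheory.IndepFun (fun ω => history act ω t)
        (fun ω : ℕ → unitInterval => ω t) seedMeasure := by
      have hi : ProbabilityTheory.iIndepFun (fun i (ω : ℕ → unitInterval) => ω i) seedMeasure :=
        ProbabilityTheory.iIndepFun_infinitePi (X := fun _ x => x) (fun _ => measurable_id)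
      have hd := ProbabilityTheory.indep_iSup_of_disjoint hle hi (S := Set.Iio t) (T := {t})
        (by simp)
      rw [ProbabilityTheory.IndepFun_iff_Indep]
      refine ProbabilityTheory.indep_of_indep_of_le_right
        (ProbabilityTheory.indep_of_indep_of_le_left hd ?_) ?_
      · exact (history_measurable act hact t).comap_le
      · exact le_biSup (fun i => MeasurableSpace.comap
          (fun ω : ℕ → unitInterval => ω i) inferInstance) (Set.mem_singleton t)
    have hmap : seedMeasure.map (fun ω : ℕ → unitInterval => ω t) = volume :=
      Measure.infinitePi_map_eval _ t
    have hprod := (ProbabilityTheory.indepFun_iff_map_prod_eq_prod_map_map hmeas.aemeasurable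
      (measurable_pi_apply t).aemeasurable).1 hind
    rw [hmap] at hprod
    have hF : Measurable (fun x : List ℕ × unitInterval => F (act x.1 x.2 :: x.1)) := by
      refine measurable_from_prod_countable_right fun h => ?_
      have : Measurable (act h) := measurable_to_countable' fun a => hact h a
      exact (measurable_from_top (f := fun a : ℕ => F (a :: h))).comp this
    calc ∫⁻ ω, F (history act ω (t + 1)) ∂seedMeasure
        = ∫⁻ x, F (act x.1 x.2 :: x.1)
            ∂(seedMeasure.map fun ω => (history act ω t, ω t)) := by
          rw [lintegral_map hF (hmeas.prodMk (measurable_pi_apply t))]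
          rfl
      _ = ∫⁻ h, (∫⁻ u : unitInterval, F (act h u :: h))
            ∂(seedMeasure.map fun ω => history act ω t) := by
          rw [hprod, lintegral_prod _ hF.aemeasurable]
      _ = ∫⁻ ω, (∫⁻ u : unitInterval, F (act (history act ω t) u :: history act ω t))
            ∂seedMeasure := by
          rw [lintegral_map measurable_from_top hmeas]
      _ ≤ ∫⁻ ω, F (history act ω t) ∂seedMeasure :=
          lintegral_mono fun ω => hstep _ (by rw [history_length]; omega)
      _ ≤ F [] := ih (by omega)

/-- Markov's inequality for such a function. -/
theorem seedMeasure_history_ge_le (act : List ℕ → unitInterval → ℕ)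
    (hact : ∀ h a, MeasurableSet {u | act h u = a}) (F : List ℕ → ENNReal) (T : ℕ)
    (hstep : ∀ h : List ℕ, h.length < T → ∫⁻ u, F (act h u :: h) ≤ F h) (h0 : F [] ≤ 1)
    (c : ENNReal) (hc : c ≠ 0) (hc' : c ≠ ⊤) :
    seedMeasure {ω | c ≤ F (history act ω T)} ≤ c⁻¹ := by
  let _ : MeasurableSpace (List ℕ) := ⊤
  have hmeas : Measurable (fun ω => F (history act ω T)) :=
    (measurable_from_top (f := F)).comp ((history_measurable act hact T).mono
      (iSup₂_le fun i _ => (measurable_pi_apply i).comap_le) le_rfl)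
  refine (meas_ge_le_lintegral_div hmeas.aemeasurable hc hc').trans ?_
  rw [ENNReal.div_eq_inv_mul]
  calc c⁻¹ * _ ≤ c⁻¹ * 1 := by
        gcongr
        exact (lintegral_history_le act hact F T hstep T le_rfl).trans h0
    _ = c⁻¹ := mul_one _

/-! ### Gradients of gradient-stable approximations -/

theorem orthant_add {d : ℕ} {x y : Fin d → ℝ} (hx : x ∈ orthant d) (hy : y ∈ orthant d) :
    x + y ∈ orthant d := fun i => add_nonneg (hx i) (hy i)

theorem orthant_smul {d : ℕ} {x : Fin d → ℝ} (hx : x ∈ orthant d) {c : ℝ} (hc : 0 ≤ c) :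
    c • x ∈ orthant d := fun i => mul_nonneg hc (hx i)

theorem zero_mem_orthant (d : ℕ) : (0 : Fin d → ℝ) ∈ orthant d := fun _ => le_rfl

theorem one_mem_orthant (d : ℕ) : (1 : Fin d → ℝ) ∈ orthant d := fun _ => zero_le_one

theorem fderivWithin_eq_sum_orthantGrad {d : ℕ} (Ψ : (Fin d → ℝ) → ℝ) (x v : Fin d → ℝ) :
    fderivWithin ℝ Ψ (orthant d) x v = ∑ i, orthantGrad Ψ x i * v i := by
  conv_lhs => rw [pi_eq_sum_univ' v, map_sum]
  refine Finset.sum_congr rfl fun i _ => ?_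
  rw [map_smul, smul_eq_mul, mul_comm]; rfl

/-- The derivative of `Ψ` at the start of a segment in the orthant, in terms of the gradient. -/
theorem hasDerivWithinAt_segment {d : ℕ} {Ψ : (Fin d → ℝ) → ℝ}
    (hd : DifferentiableOn ℝ Ψ (orthant d)) {x z : Fin d → ℝ} (hx : x ∈ orthant d)
    (hz : z ∈ orthant d) :
    Set.MapsTo (fun t : ℝ => x + t • (z - x)) (Set.Icc 0 1) (orthant d) ∧
      HasDerivWithinAt (fun t : ℝ => Ψ (x + t • (z - x)))
        (∑ i, orthantGrad Ψ x i * (z i - x i)) (Set.Icc 0 1) 0 := by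
  have hf := (hd x hx).hasFDerivWithinAt
  have hline : HasDerivWithinAt (fun t : ℝ => x + t • (z - x)) (z - x) (Set.Icc 0 1) 0 := by
    simpa using (((hasDerivAt_id (0 : ℝ)).smul_const (z - x)).const_add x).hasDerivWithinAt
  have hmaps : Set.MapsTo (fun t : ℝ => x + t • (z - x)) (Set.Icc 0 1) (orthant d) := by
    intro t ht
    have : x + t • (z - x) = (1 - t) • x + t • z := by
      ext i; simp only [Pi.add_apply, Pi.smul_apply, Pi.sub_apply, smul_eq_mul]; ring
    change x + t • (z - x) ∈ orthant d
    rw [this]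
    exact orthant_add (orthant_smul hx (by linarith [ht.2])) (orthant_smul hz ht.1)
  refine ⟨hmaps, ?_⟩
  have hf' : HasFDerivWithinAt Ψ (fderivWithin ℝ Ψ (orthant d) x) (orthant d)
      (x + (0 : ℝ) • (z - x)) := by simpa using hf
  have := hf'.comp_hasDerivWithinAt 0 hline hmaps
  rw [fderivWithin_eq_sum_orthantGrad] at this
  exact this

/-- The first-order characterization of convexity, on the closed orthant. -/
theorem add_grad_le_of_convexOn {d : ℕ} {Ψ : (Fin d → ℝ) → ℝ} (hc : ConvexOn ℝ (orthant d) Ψ)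
    (hd : DifferentiableOn ℝ Ψ (orthant d)) {x z : Fin d → ℝ} (hx : x ∈ orthant d)
    (hz : z ∈ orthant d) : Ψ x + ∑ i, orthantGrad Ψ x i * (z i - x i) ≤ Ψ z := by
  obtain ⟨hmaps, hcomp⟩ := hasDerivWithinAt_segment hd hx hz
  have hcv : ConvexOn ℝ (Set.Icc (0 : ℝ) 1) (fun t : ℝ => Ψ (x + t • (z - x))) := by
    refine ⟨convex_Icc 0 1, fun a ha b hb u v hu hv huv => ?_⟩
    have := hc.2 (hmaps ha) (hmaps hb) hu hv huv
    convert this using 2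
    ext i
    simp only [Pi.add_apply, Pi.smul_apply, Pi.sub_apply, smul_eq_mul]
    linear_combination - huv * x i
  have h := hcv.le_slope_of_hasDerivWithinAt (x := 0) (y := 1) (by simp) (by simp) one_pos hcomp
  simp only [slope, vsub_eq_sub, sub_zero, inv_one, one_smul, zero_smul, add_zero,
    add_sub_cancel, smul_eq_mul, one_mul] at h
  linarith

namespace IsGradStableApprox

variable {d : ℕ} {N : Seminorm ℝ (Fin d → ℝ)} {δ α γ ε : ℝ} {Ψ : (Fin d → ℝ) → ℝ}

theorem grad_le_increment (h : IsGradStableApprox N δ α γ ε Ψ) {x y : Fin d → ℝ}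
    (hx : x ∈ orthant d) (hy : y ∈ orthant d) :
    ∑ i, orthantGrad Ψ x i * y i ≤ Ψ (x + y) - Ψ x := by
  have := add_grad_le_of_convexOn h.convex h.differentiable hx (orthant_add hx hy)
  simp only [Pi.add_apply, add_sub_cancel_left] at this
  linarith

theorem increment_le_grad (h : IsGradStableApprox N δ α γ ε Ψ) {x y : Fin d → ℝ}
    (hx : x ∈ orthant d) (hy : y ∈ orthant d) :
    Ψ (x + y) - Ψ x ≤ ∑ i, orthantGrad Ψ (x + y) i * y i := by
  have := add_grad_le_of_convexOn h.convex h.differentiable (orthant_add hx hy) hx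
  have h2 : ∑ i, orthantGrad Ψ (x + y) i * (x i - (x + y) i)
      = -∑ i, orthantGrad Ψ (x + y) i * y i := by
    rw [← Finset.sum_neg_distrib]
    exact Finset.sum_congr rfl fun i _ => by simp only [Pi.add_apply]; ring
  linarith

theorem additive_nonneg (h : IsGradStableApprox N δ α γ ε Ψ) (hε : 0 < ε) : 0 ≤ γ := by
  have h1 := h.norm_le 0 (zero_mem_orthant d)
  have h2 := h.le_norm 0 (zero_mem_orthant d)
  simp only [map_zero, mul_zero, zero_add] at h1 h2
  by_contra hγ
  have := div_neg_of_neg_of_pos (not_le.1 hγ) hε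
  linarith

/-- The gradient has dual norm at most `α`, since by subadditivity the growth of `Ψ` along a ray is
asymptotically at most `α N`. -/
theorem grad_le_norm (h : IsGradStableApprox N δ α γ ε Ψ) {x y : Fin d → ℝ}
    (hx : x ∈ orthant d) (hy : y ∈ orthant d) :
    ∑ i, orthantGrad Ψ x i * y i ≤ α * N y := by
  have key : ∀ t : ℝ, 0 < t → t * (∑ i, orthantGrad Ψ x i * y i - α * N y) ≤ γ / ε := by
    intro t ht
    have h1 := h.grad_le_increment hx (orthant_smul hy ht.le)
    have h2 := h.subadditive x hx _ (orthant_smul hy ht.le)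
    have h3 := h.le_norm _ (orthant_smul hy ht.le)
    rw [map_smul_eq_mul, Real.norm_of_nonneg ht.le] at h3
    have h4 : ∑ i, orthantGrad Ψ x i * (t • y) i = t * ∑ i, orthantGrad Ψ x i * y i := by
      rw [Finset.mul_sum]
      exact Finset.sum_congr rfl fun i _ => by simp only [Pi.smul_apply, smul_eq_mul]; ring
    rw [h4] at h1
    linarith
  by_contra hlt
  push Not at hlt
  set D := ∑ i, orthantGrad Ψ x i * y i - α * N y
  have hD : 0 < D := by simp only [D]; linarith
  have h5 := key ((|γ / ε| + 1) / D) (by positivity)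
  rw [div_mul_cancel₀ _ hD.ne'] at h5
  linarith [le_abs_self (γ / ε)]

theorem grad_nonneg (h : IsGradStableApprox N δ α γ ε Ψ) {x : Fin d → ℝ}
    (hx : x ∈ orthant d) (i : Fin d) : 0 ≤ orthantGrad Ψ x i := by
  have he : Pi.single i (1 : ℝ) ∈ orthant d := fun j => by
    by_cases hj : j = i
    · subst hj; simp
    · simp [hj]
  obtain ⟨hmaps, hder⟩ := hasDerivWithinAt_segment h.differentiable hx (orthant_add hx he)
  have hval : ∑ j, orthantGrad Ψ x j * ((x + Pi.single i (1 : ℝ) : Fin d → ℝ) j - x j) = orthantGrad Ψ x i := by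
    rw [Finset.sum_eq_single i]
    · simp
    · intro j _ hj; simp [hj]
    · simp
  rw [hval] at hder
  refine hder.nonneg_of_monotoneOn ?_ ?_
  · have : AccPt (0 : ℝ) (Filter.principal (Set.Icc 0 1)) := by
      rw [accPt_iff_nhds]
      intro U hU
      obtain ⟨r, hr, hrU⟩ := Metric.mem_nhds_iff.1 hU
      refine ⟨min (r / 2) 1, ⟨hrU ?_, ?_, min_le_right _ _⟩, ?_⟩
      · rw [Metric.mem_ball, Real.dist_eq, sub_zero, abs_of_pos (by positivity)]
        exact (min_le_left _ _).trans_lt (by linarith)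
      · positivity
      · positivity
    exact this
  · intro s hs t ht hst
    refine h.monotone _ (hmaps hs) _ (hmaps ht) fun j => ?_
    simp only [Pi.add_apply, Pi.smul_apply, smul_eq_mul, add_sub_cancel_left]
    have := mul_le_mul_of_nonneg_right hst (he j)
    linarith

theorem sum_grad_mul_nonneg (h : IsGradStableApprox N δ α γ ε Ψ) {x y : Fin d → ℝ}
    (hx : x ∈ orthant d) (hy : y ∈ orthant d) : 0 ≤ ∑ i, orthantGrad Ψ x i * y i :=
  Finset.sum_nonneg fun i _ => mul_nonneg (h.grad_nonneg hx i) (hy i)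

/-- Gradient stability, tested against a non-negative direction. -/
theorem grad_le_exp_mul_grad (h : IsGradStableApprox N δ α γ ε Ψ)
    {x y z : Fin d → ℝ} (hx : x ∈ orthant d) (hy : y ∈ orthant d) (hz : z ∈ orthant d) {b : ℝ}
    (hb : ε * N y + δ ≤ b) :
    ∑ i, orthantGrad Ψ x i * z i ≤ Real.exp b * ∑ i, orthantGrad Ψ (x + y) i * z i := by
  rw [Finset.mul_sum]
  refine Finset.sum_le_sum fun i _ => ?_
  rw [← mul_assoc]
  refine mul_le_mul_of_nonneg_right ?_ (hz i)
  calc orthantGrad Ψ x i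
      = Real.exp (ε * N y + δ) * (Real.exp (-ε * N y - δ) * orthantGrad Ψ x i) := by
        rw [← mul_assoc, ← Real.exp_add, show ε * N y + δ + (-ε * N y - δ) = 0 by ring,
          Real.exp_zero, one_mul]
    _ ≤ Real.exp b * orthantGrad Ψ (x + y) i :=
        mul_le_mul (Real.exp_le_exp.2 hb) (h.gradient_stable x hx y hy i)
          (mul_nonneg (Real.exp_pos _).le (h.grad_nonneg hx i)) (Real.exp_pos _).le

end IsGradStableApprox

/-- The multiplicative error of a family of approximations at all scales is at least `1`. -/
theorem one_le_of_isGradStableApprox {d : ℕ} {N : Seminorm ℝ (Fin d → ℝ)} {δ α γ : ℝ}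
    {Ψ : ℝ → (Fin d → ℝ) → ℝ} (h : ∀ ε > 0, IsGradStableApprox N δ α γ ε (Ψ ε))
    (hN : 0 < N 1) : 1 ≤ α := by
  have hγ : 0 ≤ γ := (h 1 one_pos).additive_nonneg one_pos
  by_contra hα
  push Not at hα
  set D := (1 - α) * N 1 with hD
  have hDpos : 0 < D := mul_pos (by linarith) hN
  have hε : 0 < (γ + 1) / D := by positivity
  have h1 := (h _ hε).norm_le 1 (one_mem_orthant d)
  have h2 := (h _ hε).le_norm 1 (one_mem_orthant d)
  have h3 : γ / ((γ + 1) / D) < D := by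
    rw [div_div_eq_mul_div, div_lt_iff₀ (by linarith)]
    nlinarith
  linarith

/-! ### Sampling an action from a random number -/

/-- The probability with which an arm of weight `p k` is played: a fraction `mix` of the weight, and
`0` if the weight is below the cutoff. -/
def playProb (cutoff mix : ℝ) (p : ℕ → ℝ) (k : ℕ) : ℝ := if cutoff ≤ p k then mix * p k else 0

/-- The total probability of the arms below `k`. -/
def cumProb (cutoff mix : ℝ) (p : ℕ → ℝ) (k : ℕ) : ℝ :=
  ∑ j ∈ Finset.range k, playProb cutoff mix p j

/-- The last arm `j < k` above the cutoff whose interval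
`[cumProb j, cumProb (j + 1))` starts at or below `u` (`0` if there is none). -/
def pickArm (cutoff mix : ℝ) (p : ℕ → ℝ) (u : ℝ) : ℕ → ℕ
  | 0 => 0
  | k + 1 => if cutoff ≤ p k ∧ cumProb cutoff mix p k ≤ u then k else pickArm cutoff mix p u k

/-- The arm whose interval contains `u`; the null action `0` if `u` lies above all intervals. -/
def sampleArm (n : ℕ) (cutoff mix : ℝ) (p : ℕ → ℝ) (u : ℝ) : ℕ :=
  if cumProb cutoff mix p n ≤ u then 0 else pickArm cutoff mix p u n

section Sampling

variable {cutoff mix : ℝ} {p : ℕ → ℝ} {n : ℕ}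

theorem playProb_nonneg (hm : 0 ≤ mix) (hp : ∀ k, 0 ≤ p k) (k : ℕ) :
    0 ≤ playProb cutoff mix p k := by
  unfold playProb; split_ifs
  · exact mul_nonneg hm (hp k)
  · exact le_rfl

theorem cumProb_succ (k : ℕ) :
    cumProb cutoff mix p (k + 1) = cumProb cutoff mix p k + playProb cutoff mix p k :=
  Finset.sum_range_succ _ _

theorem cumProb_mono (hm : 0 ≤ mix) (hp : ∀ k, 0 ≤ p k) : Monotone (cumProb cutoff mix p) :=
  monotone_nat_of_le_succ fun k => by
    rw [cumProb_succ]; linarith [playProb_nonneg (cutoff := cutoff) hm hp k]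

theorem cumProb_le_mix (hm : 0 ≤ mix) (hp : ∀ k, 0 ≤ p k)
    (hsum : ∑ k ∈ Finset.range n, p k ≤ 1) : cumProb cutoff mix p n ≤ mix := by
  calc cumProb cutoff mix p n ≤ ∑ k ∈ Finset.range n, mix * p k := by
        refine Finset.sum_le_sum fun k _ => ?_
        unfold playProb; split_ifs
        · exact le_rfl
        · exact mul_nonneg hm (hp k)
    _ = mix * ∑ k ∈ Finset.range n, p k := by rw [Finset.mul_sum]
    _ ≤ mix * 1 := by gcongr
    _ = mix := mul_one _

theorem pickArm_eq_zero_or (u : ℝ) (m : ℕ) : pickArm cutoff mix p u m = 0 ∨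
    (pickArm cutoff mix p u m < m ∧ cutoff ≤ p (pickArm cutoff mix p u m) ∧
      cumProb cutoff mix p (pickArm cutoff mix p u m) ≤ u) := by
  induction m with
  | zero => exact Or.inl rfl
  | succ m ih =>
    unfold pickArm
    split_ifs with h
    · exact Or.inr ⟨Nat.lt_succ_self m, h.1, h.2⟩
    · rcases ih with h0 | h1
      · exact Or.inl h0
      · exact Or.inr ⟨h1.1.trans (Nat.lt_succ_self m), h1.2⟩

theorem sampleArm_eq_zero_or (u : ℝ) : sampleArm n cutoff mix p u = 0 ∨
    (sampleArm n cutoff mix p u < n ∧ cutoff ≤ p (sampleArm n cutoff mix p u)) := by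
  unfold sampleArm
  split_ifs
  · exact Or.inl rfl
  · exact (pickArm_eq_zero_or u n).imp id fun h => ⟨h.1, h.2.1⟩

theorem sampleArm_eq_iff (hm : 0 ≤ mix) (hp : ∀ k, 0 ≤ p k) {k : ℕ} (hk : 0 < k) (hkn : k < n)
    (hck : cutoff ≤ p k) (u : ℝ) : sampleArm n cutoff mix p u = k ↔
      cumProb cutoff mix p k ≤ u ∧ u < cumProb cutoff mix p (k + 1) := by
  have hmono := cumProb_mono (cutoff := cutoff) hm hp
  constructor
  · intro h
    unfold sampleArm at h
    split_ifs at h with hn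
    · omega
    · refine ⟨?_, ?_⟩
      · rcases pickArm_eq_zero_or (cutoff := cutoff) (mix := mix) (p := p) u n with h0 | h1
        · omega
        · rw [h] at h1; exact h1.2.2
      · by_contra hcon
        push Not at hcon
        -- an arm below the cutoff has an empty interval, so the scan would go on to the end
        have key : ∀ m, k + 1 ≤ m → pickArm cutoff mix p u m = k →
            cumProb cutoff mix p m ≤ u := by
          intro m hkm
          induction m, hkm using Nat.le_induction with
          | base => exact fun _ => hcon
          | succ m hkm ih =>
            intro hpick
            unfold pickArm at hpick
            split_ifs at hpick with hc
            · omega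
            · have hcm := ih hpick
              have hpm : ¬ cutoff ≤ p m := fun hx => hc ⟨hx, hcm⟩
              rw [cumProb_succ, playProb, if_neg hpm, add_zero]
              exact hcm
        exact hn (key n hkn h)
  · rintro ⟨h1, h2⟩
    have hlt : u < cumProb cutoff mix p n := h2.trans_le (hmono hkn)
    unfold sampleArm
    rw [if_neg (not_le.2 hlt)]
    have key : ∀ m, k + 1 ≤ m → pickArm cutoff mix p u m = k := by
      intro m hkm
      induction m, hkm using Nat.le_induction with
      | base => unfold pickArm; rw [if_pos ⟨hck, h1⟩]
      | succ m hkm ih =>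
        unfold pickArm
        rw [if_neg, ih]
        exact fun hx => absurd (hx.2.trans_lt h2) (not_lt.2 (hmono hkm))
    exact key n hkn

theorem measurable_sampleArm :
    Measurable (fun u : unitInterval => sampleArm n cutoff mix p (u : ℝ)) := by
  have hle : ∀ c : ℝ, MeasurableSet {u : unitInterval | c ≤ (u : ℝ)} := fun c =>
    measurableSet_le measurable_const measurable_subtype_coe
  have hpick : ∀ m, Measurable (fun u : unitInterval => pickArm cutoff mix p (u : ℝ) m) := by
    intro m
    induction m with
    | zero => exact measurable_const
    | succ m ih =>
      refine Measurable.ite ?_ measurable_const ih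
      by_cases hc : cutoff ≤ p m
      · simpa [hc] using hle _
      · simp [hc]
  exact Measurable.ite (hle _) measurable_const (hpick n)

theorem volume_unitInterval_Ico {a b : ℝ} (ha : 0 ≤ a) (hb : b ≤ 1) :
    volume {u : unitInterval | a ≤ (u : ℝ) ∧ (u : ℝ) < b} = ENNReal.ofReal (b - a) := by
  have hme : MeasurableEmbedding ((↑) : unitInterval → ℝ) :=
    MeasurableEmbedding.subtype_coe measurableSet_Icc
  have h1 : (volume : Measure unitInterval) = Measure.comap (↑) (volume : Measure ℝ) := rfl
  rw [h1, hme.comap_apply, ← Real.volume_Ico]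
  congr 1
  ext x
  simp only [Set.mem_image, Set.mem_ofPred_eq, Subtype.exists, Set.mem_Ico]
  constructor
  · rintro ⟨y, hy, hyab, rfl⟩; exact hyab
  · intro hx; exact ⟨x, ⟨ha.trans hx.1, hx.2.le.trans hb⟩, hx, rfl⟩

theorem volume_sampleArm_eq (hm : 0 ≤ mix) (hm1 : mix ≤ 1) (hp : ∀ k, 0 ≤ p k)
    (hsum : ∑ k ∈ Finset.range n, p k ≤ 1) {k : ℕ} (hk : 0 < k) (hkn : k < n)
    (hck : cutoff ≤ p k) :
    volume {u : unitInterval | sampleArm n cutoff mix p (u : ℝ) = k}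
      = ENNReal.ofReal (mix * p k) := by
  have hmono := cumProb_mono (cutoff := cutoff) hm hp
  have : {u : unitInterval | sampleArm n cutoff mix p (u : ℝ) = k}
      = {u : unitInterval | cumProb cutoff mix p k ≤ (u : ℝ) ∧
        (u : ℝ) < cumProb cutoff mix p (k + 1)} := by
    ext u; exact sampleArm_eq_iff hm hp hk hkn hck u
  rw [this, volume_unitInterval_Ico]
  · rw [cumProb_succ, add_sub_cancel_left, playProb, if_pos hck]
  · simpa [cumProb] using hmono (Nat.zero_le k)
  · exact (hmono hkn).trans ((cumProb_le_mix hm hp hsum).trans hm1)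

end Sampling

/-! ### The learning algorithm -/

/-- The parameters of the algorithm: the scale `ε` of the potential, the bound on the potential
increase at which it stops, the price `λ` of a unit of potential increase, the weight below which an
arm is not played, the fraction of the weights used as probabilities, and the learning rate. -/
structure LearnerParams where
  scale : ℝ
  threshold : ℝ
  price : ℝ
  cutoff : ℝ
  mix : ℝ
  rate : ℝ

/-- The state of the algorithm: the logarithms of the unnormalized weights, the total cost vector,
and an upper bound on the increase of the potential. The other fields serve the analysis only; all
sums are over the rounds before the algorithm has stopped: the total reward, the total price of the
actions played (at the gradients the algorithm used), the sum of the cost matrices, the total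
reward and price of each fixed arm, and the number of rounds. -/
structure LearnerState (n d : ℕ) where
  logw : ℕ → ℝ
  load : Fin d → ℝ
  spent : ℝ
  gain : ℝ
  paid : ℝ
  usage : Matrix (Fin d) (Fin n) ℝ
  armGain : Fin n → ℝ
  armPaid : Fin n → ℝ
  rounds : ℕ

/-- The normalized weight of arm `k`. -/
def armProb (n : ℕ) (l : ℕ → ℝ) (k : ℕ) : ℝ :=
  Real.exp (l k) / ∑ j ∈ Finset.range n, Real.exp (l j)

/-- The action with number `k`; an invalid number stands for the null action `0`. -/
def actionOf (n : ℕ) [NeZero n] (k : ℕ) : Fin n := if h : k < n then ⟨k, h⟩ else 0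

/-- The pairing of the vector `g` with column `i` of `C`. -/
def colCost {n d : ℕ} (g : Fin d → ℝ) (C : Matrix (Fin d) (Fin n) ℝ) (i : Fin n) : ℝ :=
  ∑ j, g j * C j i

/-- The rewards and costs of a round, with null action `0`. -/
structure IsRound {n d : ℕ} [NeZero n] (r : Fin n → ℝ) (C : Matrix (Fin d) (Fin n) ℝ) : Prop where
  reward_mem : ∀ i, r i ∈ Set.Icc (0 : ℝ) 1
  cost_mem : ∀ j i, C j i ∈ Set.Icc (0 : ℝ) 1
  null_reward : r 0 = 0
  null_cost : ∀ j, C j 0 = 0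

/-- The action of a round, for the random number `u`. -/
def nextAction {n d : ℕ} (P : LearnerParams) (st : LearnerState n d) (u : ℝ) : ℕ :=
  if st.spent ≤ P.threshold then sampleArm n P.cutoff P.mix (armProb n st.logw) u else 0

/-- The state after a round in which the action `a` is played. The gradients that price the actions
are taken at `load + 1`, a point above the total cost vector after the round. The weights of the
arms below the cutoff grow as if their reward was `1`. -/
def nextState {n d : ℕ} [NeZero n] (P : LearnerParams) (G : (Fin d → ℝ) → Fin d → ℝ)
    (r : Fin n → ℝ) (C : Matrix (Fin d) (Fin n) ℝ) (st : LearnerState n d) (a : ℕ) :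
    LearnerState n d :=
  if st.spent ≤ P.threshold then
    { logw := fun k => st.logw k
        + (if k < n ∧ armProb n st.logw k < P.cutoff then P.rate * P.mix else 0)
        + (if k = a then P.rate * (r (actionOf n a)
            - P.price * colCost (G (st.load + 1)) C (actionOf n a)) / armProb n st.logw a else 0)
      load := st.load + fun j => C j (actionOf n a)
      spent := st.spent + colCost (G (st.load + fun j => C j (actionOf n a))) C (actionOf n a)
      gain := st.gain + r (actionOf n a)
      paid := st.paid + colCost (G (st.load + 1)) C (actionOf n a)
      usage := st.usage + C
      armGain := fun i => st.armGain i + r i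
      armPaid := fun i => st.armPaid i + colCost (G (st.load + 1)) C i
      rounds := st.rounds + 1 }
  else st

/-- The state before the first round. -/
def initState (n d : ℕ) : LearnerState n d where
  logw := 0
  load := 0
  spent := 0
  gain := 0
  paid := 0
  usage := 0
  armGain := 0
  armPaid := 0
  rounds := 0

/-- The state after a history of actions (latest first). -/
def stateOf {n d : ℕ} [NeZero n] (P : LearnerParams) (G : (Fin d → ℝ) → Fin d → ℝ)
    (r : ℕ → Fin n → ℝ) (C : ℕ → Matrix (Fin d) (Fin n) ℝ) : List ℕ → LearnerState n d
  | [] => initState n d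
  | a :: h => nextState P G (r h.length) (C h.length) (stateOf P G r C h) a

/-- The conditions on the parameters under which the weights are updated by small factors. The
number `Y` bounds the pairing of the gradients with the cost vectors. -/
structure LearnerParams.Admissible (P : LearnerParams) (Y : ℝ) : Prop where
  cutoff_pos : 0 < P.cutoff
  mix_nonneg : 0 ≤ P.mix
  mix_le : P.mix ≤ 1
  rate_nonneg : 0 ≤ P.rate
  price_nonneg : 0 ≤ P.price
  rate_mul_mix_le : P.rate * P.mix ≤ 1
  rate_mul_le : P.rate * (1 + P.price * Y) ≤ P.cutoff / 10

section Weights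

variable {n d : ℕ} [NeZero n]

theorem sum_exp_pos (l : ℕ → ℝ) : 0 < ∑ j ∈ Finset.range n, Real.exp (l j) :=
  Finset.sum_pos (fun _ _ => Real.exp_pos _) ⟨0, Finset.mem_range.2 (NeZero.pos n)⟩

theorem armProb_pos (l : ℕ → ℝ) (k : ℕ) : 0 < armProb n l k :=
  div_pos (Real.exp_pos _) (sum_exp_pos l)

theorem sum_armProb (l : ℕ → ℝ) : ∑ k ∈ Finset.range n, armProb n l k = 1 := by
  unfold armProb
  rw [← Finset.sum_div, div_self (sum_exp_pos l).ne']

theorem actionOf_val (i : Fin n) : actionOf n (i : ℕ) = i := by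
  unfold actionOf; rw [dif_pos i.2]

theorem actionOf_zero : actionOf n 0 = 0 := by
  have := actionOf_val (0 : Fin n)
  simpa using this

theorem colCost_null {r : Fin n → ℝ} {C : Matrix (Fin d) (Fin n) ℝ} (h : IsRound r C)
    (g : Fin d → ℝ) : colCost g C 0 = 0 := by
  unfold colCost
  exact Finset.sum_eq_zero fun j _ => by rw [h.null_cost, mul_zero]

theorem exp_le_quadratic {x : ℝ} (hx : |x| ≤ 1) : Real.exp x ≤ 1 + x + x ^ 2 := by
  have := (abs_le.1 (Real.abs_exp_sub_one_sub_id_le hx)).2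
  linarith

/-- A multiplicative update of a weight `p` by an importance-weighted score, with gain `b` and loss
`z`: the second-order term is at most a tenth of the first-order terms. -/
theorem mul_exp_div_le {p c η b z Y : ℝ} (hc : 0 < c) (hcp : c ≤ p) (hη : 0 ≤ η) (hb : 0 ≤ b)
    (hb1 : b ≤ 1) (hz : 0 ≤ z) (hzY : z ≤ Y) (hηc : η * (1 + Y) ≤ c / 10) :
    p * (Real.exp (η * (b - z) / p) - 1) ≤ η * (11 / 10 * b - 9 / 10 * z) ∧
      p * (Real.exp (-(η * (b - z) / p)) - 1) ≤ -(η * (9 / 10 * b - 11 / 10 * z)) := by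
  have hp : 0 < p := hc.trans_le hcp
  have hsum : η * (b + z) ≤ p / 10 :=
    calc η * (b + z) ≤ η * (1 + Y) := by gcongr
      _ ≤ c / 10 := hηc
      _ ≤ p / 10 := by linarith
  have habs : |η * (b - z)| ≤ η * (b + z) := by
    rw [abs_mul, abs_of_nonneg hη]
    exact mul_le_mul_of_nonneg_left (abs_le.2 ⟨by linarith, by linarith⟩) hη
  set x := η * (b - z) / p with hx
  have hpx : p * x = η * (b - z) := by rw [hx]; field_simp
  have hx1 : |x| ≤ 1 / 10 := by
    rw [hx, abs_div, abs_of_pos hp, div_le_iff₀ hp]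
    linarith
  have hsq : p * x ^ 2 ≤ η * (b + z) / 10 := by
    have h1 : p * x ^ 2 = |η * (b - z)| * |x| := by
      rw [← hpx, abs_mul, abs_of_pos hp, mul_assoc, abs_mul_abs_self]; ring
    rw [h1]
    calc |η * (b - z)| * |x| ≤ (η * (b + z)) * (1 / 10) := by
          gcongr
      _ = η * (b + z) / 10 := by ring
  constructor
  · have := mul_le_mul_of_nonneg_left (exp_le_quadratic (hx1.trans (by norm_num))) hp.le
    nlinarith
  · have := mul_le_mul_of_nonneg_left
      (exp_le_quadratic (x := -x) (by rw [abs_neg]; exact hx1.trans (by norm_num))) hp.le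
    nlinarith

theorem nextState_of_le {P : LearnerParams} {G : (Fin d → ℝ) → Fin d → ℝ}
    {r : Fin n → ℝ} {C : Matrix (Fin d) (Fin n) ℝ} {st : LearnerState n d}
    (h : st.spent ≤ P.threshold) (a : ℕ) : nextState P G r C st a =
    { logw := fun k => st.logw k
        + (if k < n ∧ armProb n st.logw k < P.cutoff then P.rate * P.mix else 0)
        + (if k = a then P.rate * (r (actionOf n a)
            - P.price * colCost (G (st.load + 1)) C (actionOf n a)) / armProb n st.logw a else 0)
      load := st.load + fun j => C j (actionOf n a)
      spent := st.spent + colCost (G (st.load + fun j => C j (actionOf n a))) C (actionOf n a)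
      gain := st.gain + r (actionOf n a)
      paid := st.paid + colCost (G (st.load + 1)) C (actionOf n a)
      usage := st.usage + C
      armGain := fun i => st.armGain i + r i
      armPaid := fun i => st.armPaid i + colCost (G (st.load + 1)) C i
      rounds := st.rounds + 1 } := if_pos h

theorem nextState_of_lt {P : LearnerParams} {G : (Fin d → ℝ) → Fin d → ℝ}
    {r : Fin n → ℝ} {C : Matrix (Fin d) (Fin n) ℝ} {st : LearnerState n d}
    (h : ¬ st.spent ≤ P.threshold) (a : ℕ) : nextState P G r C st a = st := if_neg h

/-- The multiplicative-weights inequality for one round. -/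
theorem sum_exp_nextState_le {P : LearnerParams} {Y : ℝ} (hP : P.Admissible Y)
    {G : (Fin d → ℝ) → Fin d → ℝ} {r : Fin n → ℝ} {C : Matrix (Fin d) (Fin n) ℝ}
    (hround : IsRound r C) {st : LearnerState n d}
    (hY : ∀ i, colCost (G (st.load + 1)) C i ∈ Set.Icc 0 Y) (hst : st.spent ≤ P.threshold)
    {a : ℕ} (ha : a = 0 ∨ (a < n ∧ P.cutoff ≤ armProb n st.logw a)) :
    ∑ k ∈ Finset.range n, Real.exp ((nextState P G r C st a).logw k)
      ≤ (∑ k ∈ Finset.range n, Real.exp (st.logw k))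
        * Real.exp (P.rate * (11 / 10 * r (actionOf n a)
            - 9 / 10 * (P.price * colCost (G (st.load + 1)) C (actionOf n a)))
          + 2 * (P.rate * P.mix) * (n * P.cutoff)) := by
  rw [nextState_of_le hst]
  dsimp only
  set W := ∑ k ∈ Finset.range n, Real.exp (st.logw k) with hW
  have hWpos : 0 < W := sum_exp_pos st.logw
  set p := armProb n st.logw with hp
  set b := r (actionOf n a)
  set z := P.price * colCost (G (st.load + 1)) C (actionOf n a) with hz
  have hb := hround.reward_mem (actionOf n a)
  have hyY := hY (actionOf n a)
  have hz0 : 0 ≤ z := mul_nonneg hP.price_nonneg hyY.1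
  have hzY : z ≤ P.price * Y := mul_le_mul_of_nonneg_left hyY.2 hP.price_nonneg
  have hηs : 0 ≤ P.rate * P.mix := mul_nonneg hP.rate_nonneg hP.mix_nonneg
  have hnull : a = 0 → b = 0 ∧ z = 0 := by
    rintro rfl
    refine ⟨?_, ?_⟩
    · simp only [b, actionOf_zero]; exact hround.null_reward
    · rw [hz, actionOf_zero, colCost_null hround, mul_zero]
  have hexp : ∀ k, Real.exp (st.logw k) = W * p k := by
    intro k
    rw [hp, armProb, ← hW]; field_simp
  have hopt : Real.exp (P.rate * P.mix) ≤ 1 + 2 * (P.rate * P.mix) := by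
    have := exp_le_quadratic (x := P.rate * P.mix) (by
      rw [abs_of_nonneg hηs]; exact hP.rate_mul_mix_le)
    nlinarith [hP.rate_mul_mix_le]
  have hterm : ∀ k ∈ Finset.range n,
      p k * Real.exp ((if k < n ∧ p k < P.cutoff then P.rate * P.mix else 0)
        + (if k = a then P.rate * (b - z) / p a else 0))
      ≤ p k + 2 * (P.rate * P.mix) * P.cutoff
        + (if k = a then P.rate * (11 / 10 * b - 9 / 10 * z) else 0) := by
    intro k hk
    have hk' := Finset.mem_range.1 hk
    have hpk : 0 < p k := armProb_pos st.logw k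
    have hextra : 0 ≤ 2 * (P.rate * P.mix) * P.cutoff :=
      mul_nonneg (by linarith) hP.cutoff_pos.le
    -- an arm that receives no feedback
    have hplain : p k * Real.exp (if k < n ∧ p k < P.cutoff then P.rate * P.mix else 0)
        ≤ p k + 2 * (P.rate * P.mix) * P.cutoff := by
      split_ifs with hc
      · calc p k * Real.exp (P.rate * P.mix) ≤ p k * (1 + 2 * (P.rate * P.mix)) := by gcongr
          _ = p k + 2 * (P.rate * P.mix) * p k := by ring
          _ ≤ p k + 2 * (P.rate * P.mix) * P.cutoff := by
              have := hc.2.le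
              gcongr
      · rw [Real.exp_zero, mul_one]; linarith
    by_cases hka : k = a
    · subst hka
      rw [if_pos rfl, if_pos rfl]
      rcases ha with h0 | ⟨_, hcut⟩
      · obtain ⟨h1, h2⟩ := hnull h0
        rw [h1, h2]
        simpa using hplain
      · rw [if_neg (fun hc => absurd hc.2 (not_lt.2 hcut)), zero_add]
        have := (mul_exp_div_le hP.cutoff_pos hcut hP.rate_nonneg hb.1 hb.2 hz0 hzY
          hP.rate_mul_le).1
        linarith
    · rw [if_neg hka, if_neg hka, add_zero, add_zero]
      exact hplain
  have han : a ∈ Finset.range n := by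
    rw [Finset.mem_range]
    rcases ha with h0 | h1
    · rw [h0]; exact NeZero.pos n
    · exact h1.1
  calc ∑ k ∈ Finset.range n, Real.exp (st.logw k
        + (if k < n ∧ p k < P.cutoff then P.rate * P.mix else 0)
        + (if k = a then P.rate * (b - z) / p a else 0))
      = W * ∑ k ∈ Finset.range n,
          p k * Real.exp ((if k < n ∧ p k < P.cutoff then P.rate * P.mix else 0)
            + (if k = a then P.rate * (b - z) / p a else 0)) := by
        rw [Finset.mul_sum]
        refine Finset.sum_congr rfl fun k _ => ?_
        rw [add_assoc, Real.exp_add, hexp, mul_assoc]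
    _ ≤ W * ∑ k ∈ Finset.range n, (p k + 2 * (P.rate * P.mix) * P.cutoff
          + (if k = a then P.rate * (11 / 10 * b - 9 / 10 * z) else 0)) :=
        mul_le_mul_of_nonneg_left (Finset.sum_le_sum hterm) hWpos.le
    _ = W * ((P.rate * (11 / 10 * b - 9 / 10 * z) + 2 * (P.rate * P.mix) * (n * P.cutoff))
          + 1) := by
        rw [Finset.sum_add_distrib, Finset.sum_add_distrib, hp, sum_armProb,
          Finset.sum_const, Finset.card_range, Finset.sum_ite_eq' (Finset.range n) a,
          if_pos han, nsmul_eq_mul]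
        ring
    _ ≤ W * Real.exp (P.rate * (11 / 10 * b - 9 / 10 * z)
          + 2 * (P.rate * P.mix) * (n * P.cutoff)) :=
        mul_le_mul_of_nonneg_left (Real.add_one_le_exp _) hWpos.le

/-- The amount by which the estimated score of arm `i` falls short of the value it is compared to,
a fraction of its total reward minus the price of its total cost. -/
def shortfall (P : LearnerParams) (i : Fin n) (st : LearnerState n d) : ℝ :=
  P.rate * P.mix * (9 / 10 * st.armGain i - 11 / 10 * (P.price * st.armPaid i)) - st.logw i

/-- The exponential of the shortfall is a supermartingale. -/
theorem lintegral_exp_shortfall_le {P : LearnerParams} {Y : ℝ} (hP : P.Admissible Y)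
    {G : (Fin d → ℝ) → Fin d → ℝ} {r : Fin n → ℝ} {C : Matrix (Fin d) (Fin n) ℝ}
    (hround : IsRound r C) {st : LearnerState n d}
    (hY : ∀ i, colCost (G (st.load + 1)) C i ∈ Set.Icc 0 Y) (i : Fin n) :
    ∫⁻ u : unitInterval, ENNReal.ofReal (Real.exp
        (shortfall P i (nextState P G r C st (nextAction P st u))))
      ≤ ENNReal.ofReal (Real.exp (shortfall P i st)) := by
  by_cases hst : st.spent ≤ P.threshold
  swap
  · simp [nextState_of_lt hst]
  have hact : ∀ u : unitInterval, nextAction P st u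
      = sampleArm n P.cutoff P.mix (armProb n st.logw) u := fun u => if_pos hst
  set p := armProb n st.logw with hp
  set z := P.price * colCost (G (st.load + 1)) C i with hz
  have hb := hround.reward_mem i
  have hz0 : 0 ≤ z := mul_nonneg hP.price_nonneg (hY i).1
  have hzY : z ≤ P.price * Y := mul_le_mul_of_nonneg_left (hY i).2 hP.price_nonneg
  have hηs : 0 ≤ P.rate * P.mix := mul_nonneg hP.rate_nonneg hP.mix_nonneg
  have hppos : ∀ k, 0 < p k := armProb_pos st.logw
  set S := shortfall P i st with hS
  set D := P.rate * P.mix * (9 / 10 * r i - 11 / 10 * z) with hD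
  have hsf : ∀ a, shortfall P i (nextState P G r C st a) = S + D
      - (if p i < P.cutoff then P.rate * P.mix else 0)
      - (if (i : ℕ) = a then P.rate * (r i - z) / p i else 0) := by
    intro a
    rw [hS, hD, shortfall, nextState_of_le hst]
    dsimp only
    rw [← hp]
    by_cases hia : (i : ℕ) = a
    · subst hia
      simp only [i.2, true_and, if_true, actionOf_val, shortfall, hz]
      ring
    · simp only [i.2, true_and, if_neg hia, shortfall, hz]
      ring
  simp_rw [hact, hsf]
  -- if the arm never gets a non-zero feedback in this round, the increment is deterministic
  have hdet : (∀ u : unitInterval, (if (i : ℕ) = sampleArm n P.cutoff P.mix p u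
        then P.rate * (r i - z) / p i else 0) = 0) →
      D ≤ (if p i < P.cutoff then P.rate * P.mix else 0) →
      ∫⁻ u : unitInterval, ENNReal.ofReal (Real.exp (S + D
        - (if p i < P.cutoff then P.rate * P.mix else 0)
        - (if (i : ℕ) = sampleArm n P.cutoff P.mix p u then P.rate * (r i - z) / p i else 0)))
      ≤ ENNReal.ofReal (Real.exp S) := by
    intro h1 h2
    simp_rw [h1]
    simp only [sub_zero, lintegral_const, measure_univ, mul_one]
    exact ENNReal.ofReal_le_ofReal (Real.exp_le_exp.2 (by linarith))
  have hDle : D ≤ P.rate * P.mix := by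
    rw [hD]
    nlinarith [hb.2]
  by_cases hi0 : i = 0
  · have h1 : r i = 0 := by rw [hi0]; exact hround.null_reward
    have h2 : z = 0 := by rw [hz, hi0, colCost_null hround, mul_zero]
    refine hdet (fun u => by simp [h1, h2]) ?_
    rw [hD, h1, h2]
    split_ifs <;> simp [hηs]
  have hipos : 0 < (i : ℕ) := by
    rcases Nat.eq_zero_or_pos (i : ℕ) with h | h
    · exact absurd (Fin.ext (by simpa using h)) hi0
    · exact h
  by_cases hcut : p i < P.cutoff
  · refine hdet (fun u => if_neg fun h => ?_) (by rw [if_pos hcut]; exact hDle)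
    rcases sampleArm_eq_zero_or (n := n) (cutoff := P.cutoff) (mix := P.mix) (p := p) (u : ℝ)
      with h0 | h1
    · omega
    · rw [← h] at h1; exact absurd h1.2 (not_le.2 hcut)
  rw [if_neg hcut]
  push Not at hcut
  simp only [sub_zero]
  set x := P.rate * (r i - z) / p i with hx
  set E : Set unitInterval := {u | sampleArm n P.cutoff P.mix p (u : ℝ) = i} with hE
  have hEmeas : MeasurableSet E := measurable_sampleArm (measurableSet_singleton _)
  have hvol : volume E = ENNReal.ofReal (P.mix * p i) :=
    volume_sampleArm_eq hP.mix_nonneg hP.mix_le (fun k => (hppos k).le) (sum_armProb st.logw).le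
      hipos i.2 hcut
  have hq0 : 0 ≤ P.mix * p i := mul_nonneg hP.mix_nonneg (hppos i).le
  have hq1 : P.mix * p i ≤ 1 := by
    have : p i ≤ 1 := by
      rw [← sum_armProb (n := n) st.logw]
      exact Finset.single_le_sum (f := armProb n st.logw) (fun k _ => (hppos k).le)
        (Finset.mem_range.2 i.2)
    exact mul_le_one₀ hP.mix_le (hppos i).le this
  have hvolc : volume Eᶜ = ENNReal.ofReal (1 - P.mix * p i) := by
    rw [prob_compl_eq_one_sub hEmeas, hvol, ENNReal.ofReal_sub _ hq0, ENNReal.ofReal_one]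
  have hstep := (mul_exp_div_le hP.cutoff_pos hcut hP.rate_nonneg hb.1 hb.2 hz0 hzY
    hP.rate_mul_le).2
  rw [← hx] at hstep
  have h1 : ∀ u ∈ E, ENNReal.ofReal (Real.exp (S + D
      - (if (i : ℕ) = sampleArm n P.cutoff P.mix p u then x else 0)))
      = ENNReal.ofReal (Real.exp (S + D - x)) := by
    intro u hu
    rw [if_pos hu.symm]
  have h2 : ∀ u ∈ Eᶜ, ENNReal.ofReal (Real.exp (S + D
      - (if (i : ℕ) = sampleArm n P.cutoff P.mix p u then x else 0)))
      = ENNReal.ofReal (Real.exp (S + D)) := by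
    intro u hu
    rw [if_neg (fun h => hu h.symm), sub_zero]
  rw [← lintegral_add_compl _ hEmeas, setLIntegral_congr_fun hEmeas h1,
    setLIntegral_congr_fun hEmeas.compl h2, setLIntegral_const, setLIntegral_const, hvol, hvolc,
    ← ENNReal.ofReal_mul (Real.exp_pos _).le, ← ENNReal.ofReal_mul (Real.exp_pos _).le,
    ← ENNReal.ofReal_add (mul_nonneg (Real.exp_pos _).le hq0)
      (mul_nonneg (Real.exp_pos _).le (by linarith))]
  refine ENNReal.ofReal_le_ofReal ?_
  have hq : P.mix * p i * (Real.exp (-x) - 1) ≤ -D := by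
    have := mul_le_mul_of_nonneg_left hstep hP.mix_nonneg
    rw [hD]
    linarith
  calc Real.exp (S + D - x) * (P.mix * p i) + Real.exp (S + D) * (1 - P.mix * p i)
      = Real.exp (S + D) * (P.mix * p i * (Real.exp (-x) - 1) + 1) := by
        rw [sub_eq_add_neg (S + D) x, Real.exp_add]; ring
    _ ≤ Real.exp (S + D) * Real.exp (-D) :=
        mul_le_mul_of_nonneg_left (by linarith [Real.add_one_le_exp (-D)]) (Real.exp_pos _).le
    _ = Real.exp S := by rw [← Real.exp_add]; ring_nf

end Weights

/-! ### Trajectories of the algorithm -/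

/-- The state after `t` rounds, for the sequence `ω` of random numbers. -/
def learnerState {n d : ℕ} [NeZero n] (P : LearnerParams) (G : (Fin d → ℝ) → Fin d → ℝ)
    (r : ℕ → Fin n → ℝ) (C : ℕ → Matrix (Fin d) (Fin n) ℝ) (ω : ℕ → unitInterval) :
    ℕ → LearnerState n d
  | 0 => initState n d
  | t + 1 => nextState P G (r t) (C t) (learnerState P G r C ω t)
      (nextAction P (learnerState P G r C ω t) (ω t))

section Trajectory

variable {n d : ℕ} [NeZero n] {P : LearnerParams} {G : (Fin d → ℝ) → Fin d → ℝ}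
  {r : ℕ → Fin n → ℝ} {C : ℕ → Matrix (Fin d) (Fin n) ℝ} {ω : ℕ → unitInterval} {T : ℕ}

theorem stateOf_history (t : ℕ) :
    stateOf P G r C (history (fun h u => nextAction P (stateOf P G r C h) u) ω t)
      = learnerState P G r C ω t := by
  induction t with
  | zero => rfl
  | succ t ih => rw [history, stateOf, history_length, ih]; rfl

theorem measurableSet_nextAction (h : List ℕ) (a : ℕ) :
    MeasurableSet {u : unitInterval | nextAction P (stateOf P G r C h) u = a} := by
  unfold nextAction
  split_ifs
  · exact measurable_sampleArm (measurableSet_singleton a)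
  · exact MeasurableSet.const _

/-- Induction along a trajectory: a property of the states persists if every round before the
algorithm has stopped preserves it. -/
theorem learnerState_induction {Q : ℕ → LearnerState n d → Prop} (h0 : Q 0 (initState n d))
    (hstay : ∀ t st, ¬ st.spent ≤ P.threshold → Q t st → Q (t + 1) st)
    (hstep : ∀ t < T, ∀ st, st.spent ≤ P.threshold → Q t st →
      ∀ a, (a = 0 ∨ (a < n ∧ P.cutoff ≤ armProb n st.logw a)) →
        Q (t + 1) (nextState P G (r t) (C t) st a)) :
    ∀ t ≤ T, Q t (learnerState P G r C ω t) := by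
  intro t
  induction t with
  | zero => exact fun _ => h0
  | succ t ih =>
    intro ht
    have hq := ih (by omega)
    rw [learnerState]
    by_cases hst : (learnerState P G r C ω t).spent ≤ P.threshold
    · refine hstep t (by omega) _ hst hq _ ?_
      rw [nextAction, if_pos hst]
      exact sampleArm_eq_zero_or _
    · rw [nextState_of_lt hst]
      exact hstay t _ hst hq

variable {N : Seminorm ℝ (Fin d → ℝ)} {δ α γ ε : ℝ} {Ψ : (Fin d → ℝ) → ℝ}

theorem IsRound.col_mem {r : Fin n → ℝ} {C : Matrix (Fin d) (Fin n) ℝ} (h : IsRound r C)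
    (i : Fin n) : (fun j => C j i) ∈ orthant d := fun j => (h.cost_mem j i).1

theorem IsRound.norm_col_le {r : Fin n → ℝ} {C : Matrix (Fin d) (Fin n) ℝ} (h : IsRound r C)
    (hmono : ∀ u v : Fin d → ℝ, 0 ≤ v → v ≤ u → N v ≤ N u) (i : Fin n) :
    N (fun j => C j i) ≤ N 1 :=
  hmono _ _ (h.col_mem i) fun j => (h.cost_mem j i).2

theorem colCost_mem_Icc (h : IsGradStableApprox N δ α γ ε Ψ) (hα : 0 ≤ α)
    (hmono : ∀ u v : Fin d → ℝ, 0 ≤ v → v ≤ u → N v ≤ N u)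
    {r : Fin n → ℝ} {C : Matrix (Fin d) (Fin n) ℝ} (hround : IsRound r C) {x : Fin d → ℝ}
    (hx : x ∈ orthant d) (i : Fin n) :
    colCost (orthantGrad Ψ x) C i ∈ Set.Icc 0 (α * N 1) :=
  ⟨h.sum_grad_mul_nonneg hx (hround.col_mem i),
    (h.grad_le_norm hx (hround.col_mem i)).trans
      (mul_le_mul_of_nonneg_left (hround.norm_col_le hmono i) hα)⟩

/-- The potential is at most its initial value plus the recorded increases, so that the norm of the
load stays below the threshold until the last round before the algorithm stops. -/
theorem potential_le_spent (h : IsGradStableApprox N δ α γ ε Ψ)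
    (hmono : ∀ u v : Fin d → ℝ, 0 ≤ v → v ≤ u → N v ≤ N u)
    (hround : ∀ t < T, IsRound (r t) (C t)) (hthr : 0 ≤ γ / ε + P.threshold) :
    ∀ t ≤ T, (learnerState P (orthantGrad Ψ) r C ω t).load ∈ orthant d ∧
      Ψ (learnerState P (orthantGrad Ψ) r C ω t).load
        ≤ γ / ε + (learnerState P (orthantGrad Ψ) r C ω t).spent ∧
      N (learnerState P (orthantGrad Ψ) r C ω t).load ≤ γ / ε + P.threshold + N 1 := by
  refine learnerState_induction (Q := fun _ st => st.load ∈ orthant d ∧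
      Ψ st.load ≤ γ / ε + st.spent ∧ N st.load ≤ γ / ε + P.threshold + N 1) ?_
      (fun _ _ _ h => h) ?_
  · refine ⟨zero_mem_orthant d, ?_, ?_⟩
    · simpa [initState] using h.le_norm 0 (zero_mem_orthant d)
    · simp only [initState, map_zero]
      linarith [apply_nonneg N 1]
  · intro t ht st hst hq a _
    obtain ⟨h1, h2, _⟩ := hq
    have hc := (hround t ht).col_mem (actionOf n a)
    rw [nextState_of_le hst]
    refine ⟨orthant_add h1 hc, ?_, ?_⟩
    · have := h.increment_le_grad h1 hc
      simp only [colCost]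
      linarith
    · have e1 := map_add_le_add N st.load fun j => C t j (actionOf n a)
      have e2 := (hround t ht).norm_col_le (N := N) hmono (actionOf n a)
      have e3 := h.norm_le _ h1
      dsimp only
      linarith

theorem spent_le_exp_mul_paid (h : IsGradStableApprox N δ α γ ε Ψ) (hε : 0 ≤ ε)
    (hmono : ∀ u v : Fin d → ℝ, 0 ≤ v → v ≤ u → N v ≤ N u)
    (hround : ∀ t < T, IsRound (r t) (C t)) {b : ℝ} (hb : ε * N 1 + δ ≤ b) :
    ∀ t ≤ T, (learnerState P (orthantGrad Ψ) r C ω t).load ∈ orthant d ∧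
      (learnerState P (orthantGrad Ψ) r C ω t).spent
        ≤ Real.exp b * (learnerState P (orthantGrad Ψ) r C ω t).paid ∧
      0 ≤ (learnerState P (orthantGrad Ψ) r C ω t).paid := by
  refine learnerState_induction (Q := fun _ st => st.load ∈ orthant d ∧
      st.spent ≤ Real.exp b * st.paid ∧ 0 ≤ st.paid) ⟨zero_mem_orthant d, by simp [initState]⟩
      (fun _ _ _ h => h) ?_
  intro t ht st hst hq a _
  obtain ⟨h1, h2, h3⟩ := hq
  set c : Fin d → ℝ := fun j => C t j (actionOf n a) with hcdef
  have hc : c ∈ orthant d := (hround t ht).col_mem (actionOf n a)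
  have hc1 : (1 : Fin d → ℝ) - c ∈ orthant d := fun j =>
    sub_nonneg.2 ((hround t ht).cost_mem j _).2
  have hcle : (1 : Fin d → ℝ) - c ≤ 1 := sub_le_self _ hc
  have key := h.grad_le_exp_mul_grad (orthant_add h1 hc) hc1 hc (b := b)
    (le_trans (by have := mul_le_mul_of_nonneg_left (hmono _ _ hc1 hcle) hε; linarith) hb)
  rw [show st.load + c + (1 - c) = st.load + 1 by abel] at key
  rw [nextState_of_le hst]
  refine ⟨orthant_add h1 hc, ?_, ?_⟩
  · simp only [colCost]
    rw [mul_add]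
    exact add_le_add h2 key
  · exact add_nonneg h3 (h.sum_grad_mul_nonneg (orthant_add h1 (one_mem_orthant d)) hc)

theorem usage_mem (hround : ∀ t < T, IsRound (r t) (C t)) :
    ∀ t ≤ T, ∀ j i, 0 ≤ (learnerState P G r C ω t).usage j i ∧
      (learnerState P G r C ω t).usage j i ≤ ∑ s ∈ Finset.range T, C s j i := by
  intro t ht j i
  have key : ∀ t ≤ T, 0 ≤ (learnerState P G r C ω t).usage j i ∧
      (t ≤ T → (learnerState P G r C ω t).usage j i ≤ ∑ s ∈ Finset.range t, C s j i) := by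
    refine learnerState_induction (Q := fun t st => 0 ≤ st.usage j i ∧
      (t ≤ T → st.usage j i ≤ ∑ s ∈ Finset.range t, C s j i)) (by simp [initState]) ?_ ?_
    · intro t st _ hq
      refine ⟨hq.1, fun ht => ?_⟩
      rw [Finset.sum_range_succ]
      have := ((hround t (by omega)).cost_mem j i).1
      linarith [hq.2 (by omega)]
    · intro t ht st hst hq a _
      rw [nextState_of_le hst]
      have := ((hround t (by omega)).cost_mem j i).1
      refine ⟨by simpa using add_nonneg hq.1 this, fun _ => ?_⟩
      rw [Finset.sum_range_succ]
      simpa using hq.2 ht.le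
  refine ⟨(key t ht).1, ((key t ht).2 ht).trans ?_⟩
  exact Finset.sum_le_sum_of_subset_of_nonneg (Finset.range_subset_range.2 ht) fun s hs _ =>
    ((hround s (Finset.mem_range.1 hs)).cost_mem j i).1

/-- The total price of a fixed mixture `x` of the arms, at the gradients the algorithm used. The
load of the mixture is added to the load of the algorithm inside the potential: by gradient
stability this changes the gradients by the factor `exp b` only, however large the load of the
algorithm is, and the increases of the potential telescope. -/
theorem mixture_price_le (h : IsGradStableApprox N δ α γ ε Ψ) (hε : 0 ≤ ε)
    (hmono : ∀ u v : Fin d → ℝ, 0 ≤ v → v ≤ u → N v ≤ N u)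
    (hround : ∀ t < T, IsRound (r t) (C t)) {b : ℝ} {x : Fin n → ℝ} (hx : ∀ i, 0 ≤ x i)
    (hb : ε * N (∑ t ∈ Finset.range T, (C t).mulVec x) + δ ≤ b) :
    ∑ i, x i * (learnerState P (orthantGrad Ψ) r C ω T).armPaid i
        + (learnerState P (orthantGrad Ψ) r C ω T).paid
      ≤ Real.exp b * (Ψ ((learnerState P (orthantGrad Ψ) r C ω T).load + 1
          + (learnerState P (orthantGrad Ψ) r C ω T).usage.mulVec x) - Ψ 1) := by
  have hmul0 : ∀ M : Matrix (Fin d) (Fin n) ℝ, (∀ j i, 0 ≤ M j i) → M.mulVec x ∈ orthant d :=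
    fun M hM j => by
      simp only [Matrix.mulVec, dotProduct]
      exact Finset.sum_nonneg fun i _ => mul_nonneg (hM j i) (hx i)
  have hnorm : ∀ M : Matrix (Fin d) (Fin n) ℝ, (∀ j i, 0 ≤ M j i) →
      (∀ j i, M j i ≤ ∑ s ∈ Finset.range T, C s j i) → ε * N (M.mulVec x) + δ ≤ b := by
    intro M hM hM'
    refine le_trans ?_ hb
    have : M.mulVec x ≤ ∑ t ∈ Finset.range T, (C t).mulVec x := by
      intro j
      rw [Finset.sum_apply]
      simp only [Matrix.mulVec, dotProduct]
      rw [Finset.sum_comm]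
      refine Finset.sum_le_sum fun i _ => ?_
      rw [← Finset.sum_mul]
      exact mul_le_mul_of_nonneg_right (hM' j i) (hx i)
    have := mul_le_mul_of_nonneg_left (hmono _ _ (hmul0 M hM) this) hε
    linarith
  have key : ∀ t ≤ T, (learnerState P (orthantGrad Ψ) r C ω t).load ∈ orthant d ∧
      (∀ j i, 0 ≤ (learnerState P (orthantGrad Ψ) r C ω t).usage j i) ∧
      ((∀ j i, (learnerState P (orthantGrad Ψ) r C ω t).usage j i
        ≤ ∑ s ∈ Finset.range T, C s j i) →
      ∑ i, x i * (learnerState P (orthantGrad Ψ) r C ω t).armPaid i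
        + (learnerState P (orthantGrad Ψ) r C ω t).paid
      ≤ Real.exp b * (Ψ ((learnerState P (orthantGrad Ψ) r C ω t).load + 1
          + (learnerState P (orthantGrad Ψ) r C ω t).usage.mulVec x) - Ψ 1)) := by
    refine learnerState_induction (Q := fun _ st => st.load ∈ orthant d ∧
      (∀ j i, 0 ≤ st.usage j i) ∧ ((∀ j i, st.usage j i ≤ ∑ s ∈ Finset.range T, C s j i) →
      ∑ i, x i * st.armPaid i + st.paid
        ≤ Real.exp b * (Ψ (st.load + 1 + st.usage.mulVec x) - Ψ 1))) ?_ (fun _ _ _ h => h) ?_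
    · refine ⟨zero_mem_orthant d, fun _ _ => le_rfl, fun _ => ?_⟩
      simp [initState]
    · intro t ht st hst hq a _
      obtain ⟨h1, h2, h3⟩ := hq
      have hC0 : ∀ j i, 0 ≤ C t j i := fun j i => ((hround t ht).cost_mem j i).1
      rw [nextState_of_le hst]
      dsimp only
      set c : Fin d → ℝ := fun j => C t j (actionOf n a) with hcdef
      have hc : c ∈ orthant d := (hround t ht).col_mem (actionOf n a)
      refine ⟨orthant_add h1 hc, fun j i => add_nonneg (h2 j i) (hC0 j i), fun hle => ?_⟩
      have hle' : ∀ j i, st.usage j i ≤ ∑ s ∈ Finset.range T, C s j i := fun j i =>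
        le_trans (le_add_of_nonneg_right (hC0 j i)) (hle j i)
      have ih := h3 hle'
      set g := orthantGrad Ψ (st.load + 1) with hg
      set y := (C t).mulVec x with hy
      set Y := st.usage.mulVec x with hY
      have hy0 : y ∈ orthant d := hmul0 _ hC0
      have hY0 : Y ∈ orthant d := hmul0 _ h2
      have hl1 : st.load + 1 ∈ orthant d := orthant_add h1 (one_mem_orthant d)
      have hYy : (st.usage + C t).mulVec x = Y + y := Matrix.add_mulVec _ _ _
      have hnY := hnorm _ h2 hle'
      have hnYy := hnorm (st.usage + C t) (fun j i => add_nonneg (h2 j i) (hC0 j i)) hle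
      rw [hYy] at hnYy ⊢
      have e1 := h.grad_le_exp_mul_grad hl1 hY0 hy0 hnY
      have e2 := h.grad_le_exp_mul_grad hl1 (orthant_add hY0 hy0) hc hnYy
      have e3 := h.grad_le_increment (orthant_add hl1 hY0) hy0
      have e4 := h.grad_le_increment (orthant_add hl1 (orthant_add hY0 hy0)) hc
      have e5 : ∑ i, x i * (st.armPaid i + colCost g (C t) i)
          = ∑ i, x i * st.armPaid i + ∑ j, g j * y j := by
        simp only [mul_add, Finset.sum_add_distrib]
        congr 1
        simp only [hy, colCost, Matrix.mulVec, dotProduct, Finset.mul_sum]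
        rw [Finset.sum_comm]
        exact Finset.sum_congr rfl fun _ _ => Finset.sum_congr rfl fun _ _ => by ring
      have e6 : st.load + c + 1 + (Y + y) = st.load + 1 + (Y + y) + c := by abel
      have e7 : st.load + 1 + Y + y = st.load + 1 + (Y + y) := by abel
      rw [e7] at e3
      rw [e5, e6]
      have e8 := mul_le_mul_of_nonneg_left e3 (Real.exp_pos b).le
      have e9 := mul_le_mul_of_nonneg_left e4 (Real.exp_pos b).le
      have e10 : colCost g (C t) (actionOf n a) = ∑ j, g j * c j := rfl
      rw [e10]
      linarith
  exact (key T le_rfl).2.2 fun j i => (usage_mem hround T le_rfl j i).2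

theorem armGain_eq_of_active (i : Fin n) :
    ∀ t ≤ T, (learnerState P G r C ω t).spent ≤ P.threshold →
      (learnerState P G r C ω t).armGain i = ∑ s ∈ Finset.range t, r s i := by
  refine learnerState_induction (Q := fun t st => st.spent ≤ P.threshold →
    st.armGain i = ∑ s ∈ Finset.range t, r s i) (fun _ => by simp [initState])
    (fun _ _ h1 _ h3 => absurd h3 h1) ?_
  intro t _ st hst hq a _ _
  rw [nextState_of_le hst, Finset.sum_range_succ, ← hq hst]

theorem gain_nonneg (hround : ∀ t < T, IsRound (r t) (C t)) :
    ∀ t ≤ T, 0 ≤ (learnerState P G r C ω t).gain := by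
  refine learnerState_induction (Q := fun _ st => 0 ≤ st.gain) (by simp [initState])
    (fun _ _ _ h => h) ?_
  intro t ht st hst hq a _
  rw [nextState_of_le hst]
  exact add_nonneg hq ((hround t ht).reward_mem _).1

theorem armGain_armPaid_rounds (hround : ∀ t < T, IsRound (r t) (C t)) :
    ∀ t ≤ T, (∀ i, 0 ≤ (learnerState P G r C ω t).armGain i) ∧
      (learnerState P G r C ω t).armGain 0 = 0 ∧ (learnerState P G r C ω t).armPaid 0 = 0 ∧
      (learnerState P G r C ω t).rounds ≤ t := by
  refine learnerState_induction (Q := fun t st => (∀ i, 0 ≤ st.armGain i) ∧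
    st.armGain 0 = 0 ∧ st.armPaid 0 = 0 ∧ st.rounds ≤ t) (by simp [initState])
    (fun t st _ h => ⟨h.1, h.2.1, h.2.2.1, h.2.2.2.trans (Nat.le_succ t)⟩) ?_
  intro t ht st hst hq a _
  obtain ⟨h1, h2, h3, h4⟩ := hq
  rw [nextState_of_le hst]
  refine ⟨fun i => add_nonneg (h1 i) ((hround t ht).reward_mem i).1, ?_, ?_, ?_⟩
  · dsimp only; rw [h2, (hround t ht).null_reward, add_zero]
  · dsimp only; rw [h3, colCost_null (hround t ht), add_zero]
  · exact Nat.succ_le_succ h4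

/-- The multiplicative-weights inequality for all rounds together. -/
theorem sum_exp_logw_le (h : IsGradStableApprox N δ α γ ε Ψ) (hα : 0 ≤ α)
    (hmono : ∀ u v : Fin d → ℝ, 0 ≤ v → v ≤ u → N v ≤ N u)
    (hround : ∀ t < T, IsRound (r t) (C t)) (hP : P.Admissible (α * N 1)) :
    ∀ t ≤ T, (learnerState P (orthantGrad Ψ) r C ω t).load ∈ orthant d ∧
      ∑ k ∈ Finset.range n, Real.exp ((learnerState P (orthantGrad Ψ) r C ω t).logw k)
      ≤ n * Real.exp (P.rate * (11 / 10 * (learnerState P (orthantGrad Ψ) r C ω t).gain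
          - 9 / 10 * (P.price * (learnerState P (orthantGrad Ψ) r C ω t).paid))
          + 2 * (P.rate * P.mix) * (n * P.cutoff)
            * (learnerState P (orthantGrad Ψ) r C ω t).rounds) := by
  refine learnerState_induction (Q := fun _ st => st.load ∈ orthant d ∧
    ∑ k ∈ Finset.range n, Real.exp (st.logw k) ≤ n * Real.exp (P.rate * (11 / 10 * st.gain
      - 9 / 10 * (P.price * st.paid)) + 2 * (P.rate * P.mix) * (n * P.cutoff) * st.rounds))
    ⟨zero_mem_orthant d, by simp [initState]⟩ (fun _ _ _ h => h) ?_
  intro t ht st hst hq a ha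
  obtain ⟨h1, h2⟩ := hq
  have hstep := sum_exp_nextState_le hP (hround t ht) (fun i => colCost_mem_Icc h hα hmono
    (hround t ht) (orthant_add h1 (one_mem_orthant d)) i) hst ha
  refine ⟨?_, hstep.trans ?_⟩
  · rw [nextState_of_le hst]
    exact orthant_add h1 ((hround t ht).col_mem _)
  · refine (mul_le_mul_of_nonneg_right h2 (Real.exp_pos _).le).trans (le_of_eq ?_)
    rw [mul_assoc, ← Real.exp_add, nextState_of_le hst]
    dsimp only
    congr 2
    push_cast
    ring

/-- With probability `1 - p`, no arm has an estimated score that falls short by more than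
`log (n / p)`. -/
theorem seedMeasure_shortfall_le (h : IsGradStableApprox N δ α γ ε Ψ) (hα : 0 ≤ α)
    (hmono : ∀ u v : Fin d → ℝ, 0 ≤ v → v ≤ u → N v ≤ N u)
    (hround : ∀ t < T, IsRound (r t) (C t)) (hP : P.Admissible (α * N 1)) {p : ℝ} (hp : 0 < p) :
    seedMeasure {ω | ∃ i, Real.log (n / p)
        ≤ shortfall P i (learnerState P (orthantGrad Ψ) r C ω T)} ≤ ENNReal.ofReal p := by
  have hn : (0 : ℝ) < n := Nat.cast_pos.2 (NeZero.pos n)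
  have hload : ∀ l : List ℕ, l.length ≤ T →
      (stateOf P (orthantGrad Ψ) r C l).load ∈ orthant d := by
    intro l
    induction l with
    | nil => exact fun _ => zero_mem_orthant d
    | cons a l ih =>
      intro hl
      rw [List.length_cons] at hl
      have := ih (by omega)
      rw [stateOf]
      by_cases hst : (stateOf P (orthantGrad Ψ) r C l).spent ≤ P.threshold
      · rw [nextState_of_le hst]
        exact orthant_add this ((hround _ (by omega)).col_mem _)
      · rw [nextState_of_lt hst]; exact this
  have hone : ∀ i : Fin n, seedMeasure {ω | Real.log (n / p)
      ≤ shortfall P i (learnerState P (orthantGrad Ψ) r C ω T)} ≤ ENNReal.ofReal (p / n) := by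
    intro i
    have hc : (0 : ℝ) < n / p := by positivity
    have := seedMeasure_history_ge_le
      (fun l u => nextAction P (stateOf P (orthantGrad Ψ) r C l) u)
      (fun l a => measurableSet_nextAction l a)
      (fun l => ENNReal.ofReal (Real.exp (shortfall P i (stateOf P (orthantGrad Ψ) r C l)))) T
      (fun l hl => lintegral_exp_shortfall_le hP (hround _ hl) (fun k => colCost_mem_Icc h hα hmono
        (hround _ hl) (orthant_add (hload l hl.le) (one_mem_orthant d)) k) i)
      (by simp [stateOf, shortfall, initState])
      (ENNReal.ofReal (n / p)) (by simpa using hc) ENNReal.ofReal_ne_top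
    rw [← ENNReal.ofReal_inv_of_pos hc, inv_div] at this
    refine le_trans (measure_mono fun ω hω => ?_) this
    rw [Set.mem_ofPred_eq] at hω ⊢
    rw [stateOf_history]
    refine ENNReal.ofReal_le_ofReal ?_
    rw [← Real.exp_log hc]
    exact Real.exp_le_exp.2 hω
  calc seedMeasure {ω | ∃ i, Real.log (n / p)
        ≤ shortfall P i (learnerState P (orthantGrad Ψ) r C ω T)}
      = seedMeasure (⋃ i, {ω | Real.log (n / p)
        ≤ shortfall P i (learnerState P (orthantGrad Ψ) r C ω T)}) := by
        congr 1; ext ω; simp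
    _ ≤ ∑ i : Fin n, seedMeasure {ω | Real.log (n / p)
        ≤ shortfall P i (learnerState P (orthantGrad Ψ) r C ω T)} :=
        measure_iUnion_fintype_le _ _
    _ ≤ ∑ _i : Fin n, ENNReal.ofReal (p / n) := Finset.sum_le_sum fun i _ => hone i
    _ = ENNReal.ofReal p := by
        rw [Finset.sum_const, Finset.card_univ, Fintype.card_fin, nsmul_eq_mul,
          ← ENNReal.ofReal_natCast n, ← ENNReal.ofReal_mul hn.le, mul_div_cancel₀ _ hn.ne']

end Trajectory

/-! ### The reward of the algorithm -/

/-- The parameters for budget `B`, failure probability `p`, errors `α`, `γ` and benchmark `opt`. The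
scale is such that the additive error of the potential is at most `B / 200`, and the threshold such
that the potential stays below `B / 2` until the algorithm stops. -/
def learnerParams (n T : ℕ) (B p α γ opt : ℝ) : LearnerParams where
  scale := 200 * (α + γ) / B
  threshold := B / 2 - γ / (200 * (α + γ) / B)
  price := opt / (2000 * ((α + γ) * B))
  cutoff := opt / (100 * (n * T))
  mix := 1 / (20000 * (α + γ))
  rate := 1000000 * ((α + γ) * Real.log (n / p)) / opt

/-- The regime in which the reward bound says something: the benchmark and the budget are large
compared to `S = √(T n log (n / p))`. Here `A = α + γ`, `L = log (n / p)` and `N₁ = ‖1‖`. -/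
structure LargeRegime (n T : ℕ) (A L S N₁ B opt : ℝ) : Prop where
  one_le_A : 1 ≤ A
  L_pos : 0 < L
  one_le_nL : 1 ≤ n * L
  S_nonneg : 0 ≤ S
  S_sq : S ^ 2 = T * (n * L)
  norm_pos : 0 < N₁
  opt_le : opt ≤ T
  lt_opt : 100000 * (A * S) < opt
  lt_budget : 100000 * (N₁ * S) < B

namespace LargeRegime

variable {n T : ℕ} {A L S N₁ B opt : ℝ}

theorem opt_pos (h : LargeRegime n T A L S N₁ B opt) : 0 < opt :=
  lt_of_le_of_lt (mul_nonneg (by norm_num)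
    (mul_nonneg (by linarith [h.one_le_A]) h.S_nonneg)) h.lt_opt

theorem budget_pos (h : LargeRegime n T A L S N₁ B opt) : 0 < B :=
  lt_of_le_of_lt (mul_nonneg (by norm_num) (mul_nonneg h.norm_pos.le h.S_nonneg)) h.lt_budget

theorem n_pos (h : LargeRegime n T A L S N₁ B opt) : (0 : ℝ) < n := by
  have := h.one_le_nL
  rcases Nat.eq_zero_or_pos n with h0 | h0
  · rw [h0] at this; norm_num at this
  · exact_mod_cast h0

theorem T_pos (h : LargeRegime n T A L S N₁ B opt) : (0 : ℝ) < T := h.opt_pos.trans_le h.opt_le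

/-- As the benchmark is at most `T`, a benchmark above a multiple of `A * S` forces `T`, and thus
`S`, to be large. -/
theorem le_S (h : LargeRegime n T A L S N₁ B opt) : 100000 * (A * (n * L)) ≤ S := by
  have h1 : 100000 * (A * S) ≤ T := h.lt_opt.le.trans h.opt_le
  have hA := h.one_le_A
  have hS : 0 < S := by
    have : 0 < S ^ 2 := by
      rw [h.S_sq]
      exact mul_pos h.T_pos (by linarith [h.one_le_nL])
    exact lt_of_le_of_ne h.S_nonneg fun h0 => by rw [← h0] at this; norm_num at this
  have hm := h.one_le_nL
  have h2 : 100000 * (A * S) * (n * L) ≤ S ^ 2 := by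
    rw [h.S_sq]
    exact mul_le_mul_of_nonneg_right h1 (by linarith)
  have h3 : 100000 * (A * (n * L)) * S ≤ S * S := by
    calc 100000 * (A * (n * L)) * S = 100000 * (A * S) * (n * L) := by ring
      _ ≤ S * S := by rw [← sq]; exact h2
  exact le_of_mul_le_mul_right h3 hS

theorem mul_norm_le_budget (h : LargeRegime n T A L S N₁ B opt) : 20000 * (A * N₁) ≤ B := by
  have h1 := h.le_S
  have h2 : A ≤ A * (n * L) := le_mul_of_one_le_right (by linarith [h.one_le_A]) h.one_le_nL
  have hAS : A ≤ S := by linarith [h.one_le_A]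
  have h3 : A * N₁ ≤ N₁ * S := by
    rw [mul_comm N₁]; exact mul_le_mul_of_nonneg_right hAS h.norm_pos.le
  have h4 : 0 ≤ N₁ * S := mul_nonneg h.norm_pos.le h.S_nonneg
  linarith [h.lt_budget]

theorem admissible {p α γ : ℝ} (hα : 1 ≤ α) (hγ : 0 ≤ γ)
    (h : LargeRegime n T (α + γ) (Real.log (n / p)) S N₁ B opt) :
    (learnerParams n T B p α γ opt).Admissible (α * N₁) := by
  set A := α + γ with hAdef
  set L := Real.log (n / p) with hL
  have hA := h.one_le_A
  have hA0 : 0 < A := by linarith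
  have hopt := h.opt_pos
  have hB := h.budget_pos
  have hn := h.n_pos
  have hT := h.T_pos
  have hLp := h.L_pos
  have hS0 := h.S_nonneg
  have hn1 : (1 : ℝ) ≤ n := by exact_mod_cast Nat.one_le_iff_ne_zero.2 (by rintro rfl; simp at hn)
  refine ⟨?_, ?_, ?_, ?_, ?_, ?_, ?_⟩ <;> simp only [learnerParams, ← hAdef, ← hL]
  · positivity
  · positivity
  · rw [div_le_one (by positivity)]
    linarith
  · positivity
  · positivity
  · have e : 1000000 * (A * L) / opt * (1 / (20000 * A)) = 50 * L / opt := by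
      field_simp; norm_num
    rw [e, div_le_one hopt]
    have h1 := h.le_S
    have h2 : L ≤ A * (n * L) := by
      have : L ≤ n * L := le_mul_of_one_le_left hLp.le hn1
      exact this.trans (le_mul_of_one_le_left (by positivity) hA)
    have h3 : S ≤ A * S := le_mul_of_one_le_left hS0 hA
    linarith [h.lt_opt]
  · have hrew : 1000000 * (A * L) / opt ≤ opt / (100 * (n * T)) / 20 := by
      rw [div_div, div_le_div_iff₀ hopt (by positivity)]
      have h1 : (100000 * (A * S)) ^ 2 ≤ opt ^ 2 :=
        pow_le_pow_left₀ (by positivity) h.lt_opt.le 2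
      have h2 : A * S ^ 2 ≤ A * (A * S ^ 2) := le_mul_of_one_le_left (by positivity) hA
      have h3 : 1000000 * (A * L) * (100 * (n * T) * 20) = 2000000000 * (A * S ^ 2) := by
        rw [h.S_sq]; ring
      rw [h3]
      have h4 : 0 ≤ A * S ^ 2 := by positivity
      nlinarith
    have hcost : 1000000 * (A * L) / opt * (opt / (2000 * (A * B)) * (α * N₁))
        ≤ opt / (100 * (n * T)) / 20 := by
      have e : 1000000 * (A * L) / opt * (opt / (2000 * (A * B)) * (α * N₁))
          = 500 * L * (α * N₁) / B := by
        field_simp; ring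
      rw [e, div_div, div_le_div_iff₀ hB (by positivity)]
      have h1 : (100000 * (A * S)) * (100000 * (N₁ * S)) ≤ opt * B :=
        mul_le_mul h.lt_opt.le h.lt_budget.le
          (mul_nonneg (by norm_num) (mul_nonneg h.norm_pos.le hS0)) hopt.le
      have h3 : 500 * L * (α * N₁) * (100 * (n * T) * 20) = 1000000 * (α * (N₁ * S ^ 2)) := by
        rw [h.S_sq]; ring
      rw [h3]
      have h5 : 0 ≤ N₁ * S ^ 2 := mul_nonneg h.norm_pos.le (sq_nonneg S)
      have h4 : α * (N₁ * S ^ 2) ≤ A * (N₁ * S ^ 2) :=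
        mul_le_mul_of_nonneg_right (by linarith) h5
      have h6 : 0 ≤ A * (N₁ * S ^ 2) := mul_nonneg hA0.le h5
      nlinarith
    rw [mul_add, mul_one]
    linarith

end LargeRegime

section Reward

variable {n d : ℕ} [NeZero n] {r : ℕ → Fin n → ℝ} {C : ℕ → Matrix (Fin d) (Fin n) ℝ}
  {ω : ℕ → unitInterval} {T : ℕ} {N : Seminorm ℝ (Fin d → ℝ)} {α γ : ℝ}

/-- Here `26 / 100` is `δ = 1 / 4` plus room for a small multiple of the scale. The comparison of the
algorithm with a mixture loses the square of this factor, and works since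
`11 / 10 * ((13 / 10) ^ 2 - 1) < 9 / 10`. -/
theorem exp_stability_le : Real.exp (26 / 100) ≤ 13 / 10 := by
  have := Real.exp_bound' (x := 26 / 100) (by norm_num) (by norm_num) (n := 4) (by norm_num)
  refine this.trans ?_
  norm_num [Finset.sum_range_succ, Nat.factorial]

/-- If no estimated score falls short by more than `log (n / p)`, then the learner does at least as
well as the mixture `x`, up to constant factors. -/
theorem gain_compare {P : LearnerParams} {Ψ : (Fin d → ℝ) → ℝ} {δ ε p : ℝ}
    (h : IsGradStableApprox N δ α γ ε Ψ) (hα : 0 ≤ α)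
    (hmono : ∀ u v : Fin d → ℝ, 0 ≤ v → v ≤ u → N v ≤ N u)
    (hround : ∀ t < T, IsRound (r t) (C t)) (hP : P.Admissible (α * N 1)) (hrate : 0 < P.rate)
    (hp : 0 < p) (hp1 : p ≤ 1)
    (hshort : ∀ i, shortfall P i (learnerState P (orthantGrad Ψ) r C ω T) < Real.log (n / p))
    {x : Fin n → ℝ} (hx : ∀ i, 0 ≤ x i) (hx1 : ∑ i, x i ≤ 1) :
    P.mix * (9 / 10 * ∑ i, x i * (learnerState P (orthantGrad Ψ) r C ω T).armGain i
        - 11 / 10 * (P.price * ∑ i, x i * (learnerState P (orthantGrad Ψ) r C ω T).armPaid i))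
      ≤ 11 / 10 * (learnerState P (orthantGrad Ψ) r C ω T).gain
        - 9 / 10 * (P.price * (learnerState P (orthantGrad Ψ) r C ω T).paid)
        + 2 * P.mix * (n * P.cutoff) * T + 2 * Real.log (n / p) / P.rate := by
  have hn : (0 : ℝ) < n := Nat.cast_pos.2 (NeZero.pos n)
  obtain ⟨_, hsum⟩ := sum_exp_logw_le (ω := ω) h hα hmono hround hP T le_rfl
  obtain ⟨_, hg0, hp0, hrounds⟩ := armGain_armPaid_rounds (P := P) (G := orthantGrad Ψ) (ω := ω) hround T
    le_rfl
  set st := learnerState P (orthantGrad Ψ) r C ω T with hst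
  set L := Real.log (n / p) with hL
  have hlogn : Real.log n ≤ L := by
    rw [hL]
    refine Real.log_le_log hn ?_
    rw [le_div_iff₀ hp]
    nlinarith
  have hrounds' : (st.rounds : ℝ) ≤ T := by exact_mod_cast hrounds
  set X := 11 / 10 * st.gain - 9 / 10 * (P.price * st.paid)
      + 2 * P.mix * (n * P.cutoff) * T + 2 * L / P.rate with hX
  have harm : ∀ i, P.mix * (9 / 10 * st.armGain i - 11 / 10 * (P.price * st.armPaid i)) ≤ X := by
    intro i
    have h1 : Real.exp (st.logw i) ≤ ∑ k ∈ Finset.range n, Real.exp (st.logw k) :=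
      Finset.single_le_sum (f := fun k => Real.exp (st.logw k)) (fun _ _ => (Real.exp_pos _).le)
        (Finset.mem_range.2 i.2)
    have h2 := h1.trans hsum
    rw [← Real.exp_log hn, ← Real.exp_add, Real.exp_le_exp] at h2
    have h3 := hshort i
    rw [shortfall] at h3
    have h4 : 2 * (P.rate * P.mix) * (n * P.cutoff) * st.rounds
        ≤ 2 * (P.rate * P.mix) * (n * P.cutoff) * T := by
      refine mul_le_mul_of_nonneg_left hrounds' ?_
      have := hP.cutoff_pos
      have := hP.mix_nonneg
      positivity
    have h5 : P.rate * X = P.rate * (11 / 10 * st.gain - 9 / 10 * (P.price * st.paid))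
        + 2 * (P.rate * P.mix) * (n * P.cutoff) * T + 2 * L := by
      rw [hX]; field_simp
    refine le_of_mul_le_mul_left ?_ hrate
    rw [h5]
    rw [Real.exp_log hn] at h2
    linarith
  have hX0 : 0 ≤ X := by
    have := harm 0
    rwa [hg0, hp0, mul_zero, mul_zero, mul_zero, sub_zero, mul_zero] at this
  calc P.mix * (9 / 10 * ∑ i, x i * st.armGain i
        - 11 / 10 * (P.price * ∑ i, x i * st.armPaid i))
      = ∑ i, x i * (P.mix * (9 / 10 * st.armGain i - 11 / 10 * (P.price * st.armPaid i))) := by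
        rw [Finset.mul_sum, Finset.mul_sum, Finset.mul_sum, ← Finset.sum_sub_distrib,
          Finset.mul_sum]
        exact Finset.sum_congr rfl fun i _ => by ring
    _ ≤ ∑ i, x i * X := Finset.sum_le_sum fun i _ => mul_le_mul_of_nonneg_left (harm i) (hx i)
    _ = (∑ i, x i) * X := by rw [Finset.sum_mul]
    _ ≤ 1 * X := mul_le_mul_of_nonneg_right hx1 hX0
    _ = X := one_mul X

set_option maxHeartbeats 1000000 in
/-- In the regime of large benchmark and budget, the reward is a constant fraction of
`opt / (α + γ)`, unless some estimated score falls short. -/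
theorem gain_ge {Ψ : (Fin d → ℝ) → ℝ} {B p opt S : ℝ} (hα : 1 ≤ α) (hγ : 0 ≤ γ)
    (hreg : LargeRegime n T (α + γ) (Real.log (n / p)) S (N 1) B opt)
    (h : IsGradStableApprox N (1 / 4) α γ (learnerParams n T B p α γ opt).scale Ψ)
    (hmono : ∀ u v : Fin d → ℝ, 0 ≤ v → v ≤ u → N v ≤ N u)
    (hround : ∀ t < T, IsRound (r t) (C t)) (hp : 0 < p) (hp1 : p ≤ 1)
    (hshort : ∀ i, shortfall (learnerParams n T B p α γ opt) i
      (learnerState (learnerParams n T B p α γ opt) (orthantGrad Ψ) r C ω T) < Real.log (n / p))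
    {x : Fin n → ℝ} (hx : ∀ i, 0 ≤ x i) (hx1 : ∑ i, x i ≤ 1)
    (hxB : N (∑ t ∈ Finset.range T, (C t).mulVec x) ≤ B)
    (hopt : opt / 2 ≤ ∑ t ∈ Finset.range T, ∑ i, r t i * x i) :
    1 / 100000 * (opt / (α + γ))
      ≤ (learnerState (learnerParams n T B p α γ opt) (orthantGrad Ψ) r C ω T).gain := by
  set P := learnerParams n T B p α γ opt with hPdef
  have hP : P.Admissible (α * N 1) := hreg.admissible hα hγ
  have hA : 0 < α + γ := by linarith
  have hB := hreg.budget_pos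
  have hoptpos := hreg.opt_pos
  have hn := hreg.n_pos
  have hT := hreg.T_pos
  have hL := hreg.L_pos
  have hε : 0 < P.scale := by simp only [hPdef, learnerParams]; positivity
  have hrate : 0 < P.rate := by simp only [hPdef, learnerParams]; positivity
  have hthr : P.threshold = B / 2 - γ / P.scale := rfl
  have hεA : P.scale = 200 * (α + γ) / B := rfl
  have hmix : P.mix = 1 / (20000 * (α + γ)) := rfl
  have hmix0 : 0 < P.mix := by rw [hmix]; positivity
  have hcmp := gain_compare (ω := ω) h (by linarith) hmono hround hP hrate hp hp1 hshort hx hx1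
  have hb1 : P.scale * N 1 + 1 / 4 ≤ 26 / 100 := by
    have : P.scale * N 1 ≤ 1 / 100 := by
      rw [hεA, div_mul_eq_mul_div, div_le_iff₀ hB]
      linarith [hreg.mul_norm_le_budget]
    linarith
  have hsx : ∀ M : Matrix (Fin d) (Fin n) ℝ, M.mulVec (P.mix • x) = P.mix • M.mulVec x :=
    fun M => Matrix.mulVec_smul _ _ _
  have hNtot : N (∑ t ∈ Finset.range T, (C t).mulVec (P.mix • x)) ≤ P.mix * B := by
    simp_rw [hsx]
    rw [← Finset.smul_sum, map_smul_eq_mul, Real.norm_of_nonneg hmix0.le]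
    exact mul_le_mul_of_nonneg_left hxB hmix0.le
  have hb2 : P.scale * N (∑ t ∈ Finset.range T, (C t).mulVec (P.mix • x)) + 1 / 4
      ≤ 26 / 100 := by
    have h1 := mul_le_mul_of_nonneg_left hNtot hε.le
    have h2 : P.scale * (P.mix * B) = 1 / 100 := by
      rw [hεA, hmix]; field_simp; norm_num
    linarith
  have hmixx : ∀ i, 0 ≤ (P.mix • x) i := fun i => mul_nonneg hmix0.le (hx i)
  have hprice := mixture_price_le (ω := ω) (P := P) h hε.le hmono hround hmixx hb2
  obtain ⟨_, hspent, hpaid0⟩ := spent_le_exp_mul_paid (ω := ω) (P := P) h hε.le hmono hround hb1 T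
    le_rfl
  have hthr0 : 0 ≤ γ / P.scale + P.threshold := by rw [hthr]; linarith
  obtain ⟨hload, hpot, _⟩ := potential_le_spent (ω := ω) (P := P) h hmono hround hthr0 T le_rfl
  have husage := usage_mem (P := P) (G := orthantGrad Ψ) (ω := ω) hround T le_rfl
  have hactive := fun i => armGain_eq_of_active (P := P) (G := orthantGrad Ψ) (r := r) (C := C)
    (ω := ω) (T := T) i T le_rfl
  have harms := armGain_armPaid_rounds (P := P) (G := orthantGrad Ψ) (ω := ω) hround T le_rfl
  set st := learnerState P (orthantGrad Ψ) r C ω T with hst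
  set E := Real.exp (26 / 100) with hE
  have hE0 : 0 < E := Real.exp_pos _
  have hE1 : E ≤ 13 / 10 := exp_stability_le
  set Y := st.usage.mulVec (P.mix • x) with hY
  have hY0 : Y ∈ orthant d := fun j => by
    simp only [hY, Matrix.mulVec, dotProduct]
    exact Finset.sum_nonneg fun i _ => mul_nonneg (husage j i).1 (hmixx i)
  have hYB : N Y ≤ P.mix * B := by
    refine (hmono _ _ hY0 fun j => ?_).trans hNtot
    rw [Finset.sum_apply]
    simp only [hY, Matrix.mulVec, dotProduct]
    rw [Finset.sum_comm]
    refine Finset.sum_le_sum fun i _ => ?_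
    rw [← Finset.sum_mul]
    exact mul_le_mul_of_nonneg_right (husage j i).2 (hmixx i)
  have hΨ : Ψ (st.load + 1 + Y) - Ψ 1 ≤ st.spent + B / 100 := by
    have e1 := h.subadditive _ (orthant_add hload (one_mem_orthant d)) Y hY0
    have e2 := h.subadditive _ hload 1 (one_mem_orthant d)
    have e3 := h.le_norm Y hY0
    have e4 : α * N Y ≤ α * (P.mix * B) := mul_le_mul_of_nonneg_left hYB (by linarith)
    have e5 : α * (P.mix * B) + 2 * (γ / P.scale) ≤ B / 100 := by
      have : α * (P.mix * B) + 2 * (γ / P.scale)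
          = (α / 20000 + γ / 100) / (α + γ) * B := by
        rw [hεA, hmix]; field_simp; ring
      rw [this]
      have : (α / 20000 + γ / 100) / (α + γ) ≤ 1 / 100 := by
        rw [div_le_iff₀ hA]; linarith
      nlinarith
    linarith
  set Z := ∑ i, x i * st.armPaid i with hZ
  set R := ∑ i, x i * st.armGain i with hR
  have hZ' : ∑ i, (P.mix • x) i * st.armPaid i = P.mix * Z := by
    rw [hZ, Finset.mul_sum]
    exact Finset.sum_congr rfl fun i _ => by simp only [Pi.smul_apply, smul_eq_mul]; ring
  rw [hZ'] at hprice
  -- stability enters twice, in `hprice` and in `hspent`, which gives the factor `E ^ 2`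
  have hmZ : P.mix * Z ≤ 69 / 100 * st.paid + 13 / 1000 * B := by
    have e1 : E * (Ψ (st.load + 1 + Y) - Ψ 1) ≤ E * (E * st.paid + B / 100) :=
      mul_le_mul_of_nonneg_left (by linarith) hE0.le
    have e2 : E * (E * st.paid + B / 100) ≤ 13 / 10 * (13 / 10 * st.paid + B / 100) := by
      gcongr
    linarith
  set o := opt / (α + γ) with ho
  have ho0 : 0 < o := div_pos hoptpos hA
  have hlam : P.price * B = o / 2000 := by
    simp only [hPdef, learnerParams, ho]; field_simp
  have hlam0 : 0 ≤ P.price := hP.price_nonneg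
  have hextra : 2 * P.mix * (n * P.cutoff) * T = o / 1000000 := by
    simp only [hPdef, learnerParams, ho]; field_simp; norm_num
  have hadd : 2 * Real.log (n / p) / P.rate = o / 500000 := by
    simp only [hPdef, learnerParams, ho]; field_simp; norm_num
  rw [hextra, hadd] at hcmp
  have hlZ : P.price * (P.mix * Z) ≤ 69 / 100 * (P.price * st.paid) + 13 / 1000 * (o / 2000) := by
    have := mul_le_mul_of_nonneg_left hmZ hlam0
    rw [← hlam]
    linarith
  have hmain : 9 / 10 * (P.mix * R) + 141 / 1000 * (P.price * st.paid) - 143 / 10000 * (o / 2000)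
      - 3 / 1000000 * o ≤ 11 / 10 * st.gain := by
    linarith
  have hpp : 0 ≤ P.price * st.paid := mul_nonneg hlam0 hpaid0
  by_cases hcase : st.spent ≤ P.threshold
  -- the algorithm was active in all rounds and competes with the whole benchmark
  · have hRval : opt / 2 ≤ R := by
      refine hopt.trans (le_of_eq ?_)
      rw [hR, Finset.sum_comm]
      refine Finset.sum_congr rfl fun i _ => ?_
      rw [hactive i hcase, Finset.mul_sum]
      exact Finset.sum_congr rfl fun t _ => by ring
    have hmR : o / 40000 ≤ P.mix * R := by
      have := mul_le_mul_of_nonneg_left hRval hmix0.le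
      refine le_trans (le_of_eq ?_) this
      rw [hmix, ho]; field_simp; norm_num
    linarith
  -- the algorithm has stopped, so the price paid alone accounts for a sufficient reward
  · have hR0 : 0 ≤ P.mix * R := mul_nonneg hmix0.le
      (Finset.sum_nonneg fun i _ => mul_nonneg (hx i) (harms.1 i))
    push Not at hcase
    have hγε : γ / P.scale ≤ B / 200 := by
      rw [hεA, div_div_eq_mul_div, div_le_div_iff₀ (by positivity) (by norm_num)]
      nlinarith
    have hpaid : 38 / 100 * B ≤ st.paid := by
      have : E * st.paid ≤ 13 / 10 * st.paid := mul_le_mul_of_nonneg_right hE1 hpaid0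
      rw [hthr] at hcase
      linarith
    have := mul_le_mul_of_nonneg_left hpaid hlam0
    have e : P.price * (38 / 100 * B) = 38 / 100 * (o / 2000) := by rw [← hlam]; ring
    rw [e] at this
    linarith

end Reward

/-! ### Reasoning about programs -/

namespace Prog

variable {d : ℕ} {O : ℝ → (Fin d → ℝ) → Fin d → ℝ}

/-- The memory after the execution of a program. -/
def run (O : ℝ → (Fin d → ℝ) → Fin d → ℝ) (P : Prog) (m : Mem) : Mem := (P.exec O m).1

theorem run_natConst (i k : ℕ) (m : Mem) : (natConst i k).run O m = m.setNat i k := by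
  simp [run, exec]

theorem run_natAdd (i j k : ℕ) (m : Mem) :
    (natAdd i j k).run O m = m.setNat i (m.nat j + m.nat k) := by
  simp [run, exec]

theorem run_cast (x : Cell) (i : ℕ) (m : Mem) : (cast x i).run O m = m.set x (m.nat i) := by
  simp [run, exec]

theorem run_arith (op : BinOp) (z x y : Cell) (m : Mem) :
    (arith op z x y).run O m = m.set z (op.eval (m.get x) (m.get y)) := by
  simp [run, exec]

theorem run_exp (y x : Cell) (m : Mem) :
    (exp y x).run O m = m.set y (Real.exp (m.get x)) := by
  simp [run, exec]

theorem run_log (y x : Cell) (m : Mem) :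
    (log y x).run O m = m.set y (Real.log (m.get x)) := by
  simp [run, exec]

theorem run_grad (b a : ℕ) (e : Cell) (m : Mem) :
    (grad b a e).run O m = m.setVec b (O (m.get e) fun j => m.real a j) := by
  simp [run, exec]

theorem run_seq (P Q : Prog) (m : Mem) : (seq P Q).run O m = Q.run O (P.run O m) := by
  simp [run, exec]

theorem run_ifLe (x y : Cell) (P Q : Prog) (m : Mem) :
    (ifLe x y P Q).run O m = if m.get x ≤ m.get y then P.run O m else Q.run O m := by
  simp only [run, exec]
  split_ifs <;> rfl

theorem run_ifNatLe (i j : ℕ) (P Q : Prog) (m : Mem) :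
    (ifNatLe i j P Q).run O m = if m.nat i ≤ m.nat j then P.run O m else Q.run O m := by
  simp only [run, exec]
  split_ifs <;> rfl

/-- The memory after a loop has an invariant's property if the invariant holds initially and is
preserved by the iterations. -/
theorem run_forLoop_induction {i j : ℕ} {P : Prog} {m : Mem} (I : ℕ → Mem → Prop) (h0 : I 0 m)
    (hs : ∀ k < m.nat j, ∀ m', I k m' → I (k + 1) (P.run O (m'.setNat i k))) :
    I (m.nat j) ((forLoop i j P).run O m) := by
  have key : ∀ N ≤ m.nat j, I N (Nat.rec (motive := fun _ => Mem × ℕ) (m, 1)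
      (fun k s => ((P.exec O (s.1.setNat i k)).1, s.2 + 1 + (P.exec O (s.1.setNat i k)).2)) N).1 := by
    intro N
    induction N with
    | zero => exact fun _ => h0
    | succ N ih => exact fun hN => hs N (by omega) _ (ih (by omega))
  exact key _ le_rfl

/-- Whether the program may write into array `a`. -/
def writesArr (a : ℕ) : Prog → Bool
  | natConst _ _ => false
  | natAdd _ _ _ => false
  | cast x _ => x.arr == a
  | arith _ z _ _ => z.arr == a
  | exp y _ => y.arr == a
  | log y _ => y.arr == a
  | grad b _ _ => b == a
  | seq P Q => P.writesArr a || Q.writesArr a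
  | ifLe _ _ P Q => P.writesArr a || Q.writesArr a
  | ifNatLe _ _ P Q => P.writesArr a || Q.writesArr a
  | forLoop _ _ P => P.writesArr a

/-- Whether the program may write into register `r`. -/
def writesReg (r : ℕ) : Prog → Bool
  | natConst i _ => i == r
  | natAdd i _ _ => i == r
  | cast _ _ => false
  | arith _ _ _ _ => false
  | exp _ _ => false
  | log _ _ => false
  | grad _ _ _ => false
  | seq P Q => P.writesReg r || Q.writesReg r
  | ifLe _ _ P Q => P.writesReg r || Q.writesReg r
  | ifNatLe _ _ P Q => P.writesReg r || Q.writesReg r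
  | forLoop i _ P => i == r || P.writesReg r

theorem run_real_eq {a : ℕ} (P : Prog) (h : P.writesArr a = false) (m : Mem) :
    (P.run O m).real a = m.real a := by
  induction P generalizing m with
  | natConst i k => rfl
  | natAdd i j k => rfl
  | cast x i =>
    have h' : a ≠ x.arr := by rintro rfl; simp [writesArr] at h
    rw [run_cast]; simp [Mem.set, Mem.setReal, Function.update_of_ne h']
  | arith op z x y =>
    have h' : a ≠ z.arr := by rintro rfl; simp [writesArr] at h
    rw [run_arith]; simp [Mem.set, Mem.setReal, Function.update_of_ne h']
  | exp y x =>
    have h' : a ≠ y.arr := by rintro rfl; simp [writesArr] at h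
    rw [run_exp]; simp [Mem.set, Mem.setReal, Function.update_of_ne h']
  | log y x =>
    have h' : a ≠ y.arr := by rintro rfl; simp [writesArr] at h
    rw [run_log]; simp [Mem.set, Mem.setReal, Function.update_of_ne h']
  | grad b c e =>
    have h' : a ≠ b := by rintro rfl; simp [writesArr] at h
    rw [run_grad]; simp [Mem.setVec, Function.update_of_ne h']
  | seq P Q ihP ihQ =>
    simp only [writesArr, Bool.or_eq_false_iff] at h
    rw [run_seq, ihQ h.2, ihP h.1]
  | ifLe x y P Q ihP ihQ =>
    simp only [writesArr, Bool.or_eq_false_iff] at h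
    rw [run_ifLe]; split_ifs
    · exact ihP h.1 m
    · exact ihQ h.2 m
  | ifNatLe i j P Q ihP ihQ =>
    simp only [writesArr, Bool.or_eq_false_iff] at h
    rw [run_ifNatLe]; split_ifs
    · exact ihP h.1 m
    · exact ihQ h.2 m
  | forLoop i j P ih =>
    exact run_forLoop_induction (fun _ m' => m'.real a = m.real a) rfl
      fun k _ m' hm' => (ih h _).trans hm'

theorem run_nat_eq {r : ℕ} (P : Prog) (h : P.writesReg r = false) (m : Mem) :
    (P.run O m).nat r = m.nat r := by
  induction P generalizing m with
  | natConst i k =>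
    have h' : r ≠ i := by rintro rfl; simp [writesReg] at h
    rw [run_natConst]; simp [Mem.setNat, Function.update_of_ne h']
  | natAdd i j k =>
    have h' : r ≠ i := by rintro rfl; simp [writesReg] at h
    rw [run_natAdd]; simp [Mem.setNat, Function.update_of_ne h']
  | cast x i => rfl
  | arith op z x y => rfl
  | exp y x => rfl
  | log y x => rfl
  | grad b c e => rfl
  | seq P Q ihP ihQ =>
    simp only [writesReg, Bool.or_eq_false_iff] at h
    rw [run_seq, ihQ h.2, ihP h.1]
  | ifLe x y P Q ihP ihQ =>
    simp only [writesReg, Bool.or_eq_false_iff] at h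
    rw [run_ifLe]; split_ifs
    · exact ihP h.1 m
    · exact ihQ h.2 m
  | ifNatLe i j P Q ihP ihQ =>
    simp only [writesReg, Bool.or_eq_false_iff] at h
    rw [run_ifNatLe]; split_ifs
    · exact ihP h.1 m
    · exact ihQ h.2 m
  | forLoop i j P ih =>
    simp only [writesReg, Bool.or_eq_false_iff] at h
    have h' : r ≠ i := by rintro rfl; simp at h
    refine run_forLoop_induction (fun _ m' => m'.nat r = m.nat r) rfl fun k _ m' hm' => ?_
    rw [ih h.2, ← hm']
    simp [Mem.setNat, Function.update_of_ne h']

/-- Whether all loops of the program run up to register `0` or register `1`, and these registers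
are never written into. -/
def simpleLoops : Prog → Bool
  | natConst i _ => i != 0 && i != 1
  | natAdd i _ _ => i != 0 && i != 1
  | seq P Q => P.simpleLoops && Q.simpleLoops
  | ifLe _ _ P Q => P.simpleLoops && Q.simpleLoops
  | ifNatLe _ _ P Q => P.simpleLoops && Q.simpleLoops
  | forLoop i j P => i != 0 && i != 1 && (j == 0 || j == 1) && P.simpleLoops
  | _ => true

/-- A bound on the number of steps of a program with simple loops, when the registers `0` and `1`
hold `n` and `d`. -/
def timeBound (n d : ℕ) : Prog → ℕ
  | grad _ _ _ => 1 + d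
  | seq P Q => P.timeBound n d + Q.timeBound n d
  | ifLe _ _ P Q => 1 + (P.timeBound n d + Q.timeBound n d)
  | ifNatLe _ _ P Q => 1 + (P.timeBound n d + Q.timeBound n d)
  | forLoop _ j P => 1 + (if j = 0 then n else d) * (1 + P.timeBound n d)
  | _ => 1

theorem writesReg_of_simpleLoops {P : Prog} (h : P.simpleLoops = true) :
    P.writesReg 0 = false ∧ P.writesReg 1 = false := by
  induction P with
  | seq P Q ihP ihQ =>
    simp only [simpleLoops, Bool.and_eq_true] at h
    simp [writesReg, ihP h.1, ihQ h.2]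
  | ifLe x y P Q ihP ihQ =>
    simp only [simpleLoops, Bool.and_eq_true] at h
    simp [writesReg, ihP h.1, ihQ h.2]
  | ifNatLe x y P Q ihP ihQ =>
    simp only [simpleLoops, Bool.and_eq_true] at h
    simp [writesReg, ihP h.1, ihQ h.2]
  | forLoop i j P ih =>
    simp only [simpleLoops, Bool.and_eq_true] at h
    have := h.1.1
    simp only [bne_iff_ne] at this
    simp [writesReg, ih h.2, this]
  | natConst i k => simpa [simpleLoops, writesReg] using h
  | natAdd i j k => simpa [simpleLoops, writesReg] using h
  | _ => simp [writesReg]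

theorem time_le_timeBound {n : ℕ} (P : Prog) (h : P.simpleLoops = true) (m : Mem)
    (h0 : m.nat 0 = n) (h1 : m.nat 1 = d) : (P.exec O m).2 ≤ P.timeBound n d := by
  induction P generalizing m with
  | seq P Q ihP ihQ =>
    simp only [simpleLoops, Bool.and_eq_true] at h
    have hw := writesReg_of_simpleLoops h.1
    simp only [exec, timeBound]
    exact add_le_add (ihP h.1 m h0 h1) (ihQ h.2 _ ((run_nat_eq P hw.1 m).trans h0)
      ((run_nat_eq P hw.2 m).trans h1))
  | ifLe x y P Q ihP ihQ =>
    simp only [simpleLoops, Bool.and_eq_true] at h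
    have e1 := ihP h.1 m h0 h1
    have e2 := ihQ h.2 m h0 h1
    simp only [exec, timeBound]
    split_ifs <;> omega
  | ifNatLe x y P Q ihP ihQ =>
    simp only [simpleLoops, Bool.and_eq_true] at h
    have e1 := ihP h.1 m h0 h1
    have e2 := ihQ h.2 m h0 h1
    simp only [exec, timeBound]
    split_ifs <;> omega
  | forLoop i j P ih =>
    simp only [simpleLoops, Bool.and_eq_true, Bool.or_eq_true, beq_iff_eq, bne_iff_ne] at h
    obtain ⟨⟨⟨hi0, hi1⟩, hj⟩, hP⟩ := h
    have hw := writesReg_of_simpleLoops hP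
    have key : ∀ N : ℕ,
        (Nat.rec (motive := fun _ => Mem × ℕ) (m, 1)
          (fun k s => ((P.exec O (s.1.setNat i k)).1,
            s.2 + 1 + (P.exec O (s.1.setNat i k)).2)) N).2 ≤ 1 + N * (1 + P.timeBound n d) ∧
        (Nat.rec (motive := fun _ => Mem × ℕ) (m, 1)
          (fun k s => ((P.exec O (s.1.setNat i k)).1,
            s.2 + 1 + (P.exec O (s.1.setNat i k)).2)) N).1.nat 0 = n ∧
        (Nat.rec (motive := fun _ => Mem × ℕ) (m, 1)
          (fun k s => ((P.exec O (s.1.setNat i k)).1,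
            s.2 + 1 + (P.exec O (s.1.setNat i k)).2)) N).1.nat 1 = d := by
      intro N
      induction N with
      | zero => exact ⟨by simp, h0, h1⟩
      | succ N ihN =>
        obtain ⟨e1, e2, e3⟩ := ihN
        set s := (Nat.rec (motive := fun _ => Mem × ℕ) (m, 1)
          (fun k s => ((P.exec O (s.1.setNat i k)).1,
            s.2 + 1 + (P.exec O (s.1.setNat i k)).2)) N) with hs
        have f0 : (s.1.setNat i N).nat 0 = n := by
          simp only [Mem.setNat, Function.update_of_ne (Ne.symm hi0), e2]
        have f1 : (s.1.setNat i N).nat 1 = d := by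
          simp only [Mem.setNat, Function.update_of_ne (Ne.symm hi1), e3]
        have e4 := ih hP (s.1.setNat i N) f0 f1
        refine ⟨?_, (run_nat_eq P hw.1 _).trans f0, (run_nat_eq P hw.2 _).trans f1⟩
        change s.2 + 1 + (P.exec O (s.1.setNat i N)).2 ≤ _
        rw [Nat.succ_mul]
        omega
    have hlen : m.nat j = if j = 0 then n else d := by
      rcases hj with rfl | rfl
      · simpa using h0
      · simpa using h1
    simp only [exec, timeBound, ← hlen]
    exact (key (m.nat j)).1
  | _ => simp [exec, timeBound]

end Prog

/-! ### The program of the algorithm -/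

/-- Entry `0` of array `k`, used as a scalar variable (register `4` always holds `0`). The scalars
`10` to `17` hold the parameters; the arrays `20` to `24` hold the logarithms of the weights, the
load, the potential increase, the prices of the round, and the normalized weights; arrays from `30`
on are scratch. -/
def scalar (k : ℕ) : Cell := ⟨k, 4⟩

/-- The entry of array `k` at the loop index. -/
def entry (k : ℕ) : Cell := ⟨k, 5⟩

/-- Store the inner product of the first `d` entries of two arrays in scalar `30`. -/
def dotProg (a b : ℕ) : Prog :=
  .seq (.arith .sub (scalar 30) (scalar 30) (scalar 30))
    (.forLoop 5 1 (.seq (.arith .mul (scalar 31) (entry a) (entry b))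
      (.arith .add (scalar 30) (scalar 30) (scalar 31))))

/-- Process the feedback of the previous round: update the weight of the arm played (array `20`),
the load (array `21`) and the potential increase (scalar `22`), and compute the gradient for the
new round (array `23`). -/
def scoreProg : Prog :=
  .seq (.natConst 6 1) <| .seq (dotProg 23 2) <|
  .seq (.arith .mul (scalar 30) (scalar 12) (scalar 30)) <|
  .seq (.arith .sub (scalar 30) ⟨1, 6⟩ (scalar 30)) <|
  .seq (.arith .mul (scalar 30) (scalar 15) (scalar 30)) <|
  .seq (.arith .div (scalar 30) (scalar 30) ⟨24, 3⟩)
    (.arith .add ⟨20, 3⟩ ⟨20, 3⟩ (scalar 30))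

/-- Add the cost vector of the previous round (array `2`) to the load. -/
def loadProg : Prog := .forLoop 5 1 (.arith .add (entry 21) (entry 21) (entry 2))

/-- Record the increase of the potential. -/
def spendProg : Prog :=
  .seq (.grad 33 21 (scalar 10)) <| .seq (dotProg 33 2)
    (.arith .add (scalar 22) (scalar 22) (scalar 30))

/-- Compute the gradient at the load plus the all-ones vector. -/
def priceProg : Prog :=
  .seq (.forLoop 5 1 (.arith .add (entry 34) (entry 21) (scalar 16))) (.grad 23 34 (scalar 10))

/-- Store the unnormalized weights in array `24` and their sum in scalar `35`. -/
def weightProg : Prog :=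
  .seq (.arith .sub (scalar 35) (scalar 35) (scalar 35))
    (.forLoop 5 0 (.seq (.exp (entry 24) (entry 20))
      (.arith .add (scalar 35) (scalar 35) (entry 24))))

/-- Normalize the weights, raise the scores of the arms below the cutoff, and sample the action,
with the random number in entry `0` of array `1`. -/
def sampleProg : Prog :=
  .seq (.arith .sub (scalar 36) (scalar 36) (scalar 36)) <| .seq (.natConst 3 0) <|
  .seq (.forLoop 5 0 (.seq (.arith .div (entry 24) (entry 24) (scalar 35))
    (.ifLe (scalar 13) (entry 24)
      (.seq (.ifLe (scalar 36) (scalar 1) (.natAdd 3 5 4) (.natConst 7 0))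
        (.seq (.arith .mul (scalar 37) (scalar 14) (entry 24))
          (.arith .add (scalar 36) (scalar 36) (scalar 37))))
      (.arith .add (entry 20) (entry 20) (scalar 17)))))
    (.ifLe (scalar 36) (scalar 1) (.natConst 3 0) (.natConst 7 0))

/-- The program of a round. -/
def roundProg : Prog :=
  .seq scoreProg <| .seq loadProg <| .seq spendProg <| .seq priceProg
    (.ifLe (scalar 22) (scalar 11) (.seq weightProg sampleProg) (.natConst 3 0))

section Specs

variable {d : ℕ} {O : ℝ → (Fin d → ℝ) → Fin d → ℝ}

theorem run_dotProg {a b : ℕ} (ha : a ≠ 30 ∧ a ≠ 31) (hb : b ≠ 30 ∧ b ≠ 31) {m : Mem}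
    (h4 : m.nat 4 = 0) : ((dotProg a b).run O m).real 30 0
      = ∑ j ∈ Finset.range (m.nat 1), m.real a j * m.real b j := by
  rw [dotProg, Prog.run_seq, Prog.run_arith]
  set m' := m.set (scalar 30) (BinOp.sub.eval (m.get (scalar 30)) (m.get (scalar 30))) with hm'
  have e1 : m'.nat 1 = m.nat 1 := rfl
  have ea : m'.real a = m.real a := by
    simp [hm', Mem.set, Mem.setReal, scalar, Function.update_of_ne ha.1]
  have eb : m'.real b = m.real b := by
    simp [hm', Mem.set, Mem.setReal, scalar, Function.update_of_ne hb.1]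
  rw [← e1, ← ea, ← eb]
  refine (Prog.run_forLoop_induction (I := fun k m'' => m''.real 30 0
      = ∑ j ∈ Finset.range k, m'.real a j * m'.real b j ∧ m''.nat 4 = 0
      ∧ m''.real a = m'.real a ∧ m''.real b = m'.real b) ?_ ?_).1
  · simp [hm', Mem.set, Mem.get, Mem.setReal, scalar, h4, BinOp.eval]
  · rintro k _ m'' ⟨h1, h2, h3, h5⟩
    rw [Prog.run_seq, Prog.run_arith, Prog.run_arith, Finset.sum_range_succ, ← h1]
    refine ⟨?_, ?_, ?_, ?_⟩
    · simp [Mem.set, Mem.get, Mem.setReal, Mem.setNat, scalar, entry, h2, h3, h5, BinOp.eval]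
    · simp [Mem.set, Mem.setReal, Mem.setNat, h2]
    · simp [Mem.set, Mem.setReal, Mem.setNat, scalar, Function.update_of_ne ha.1,
        Function.update_of_ne ha.2, h3]
    · simp [Mem.set, Mem.setReal, Mem.setNat, scalar, Function.update_of_ne hb.1,
        Function.update_of_ne hb.2, h5]

theorem run_scoreProg {m : Mem} (h4 : m.nat 4 = 0) (k : ℕ) :
    (scoreProg.run O m).real 20 k = m.real 20 k + (if k = m.nat 3 then
      m.real 15 0 * (m.real 1 1 - m.real 12 0
        * ∑ j ∈ Finset.range (m.nat 1), m.real 23 j * m.real 2 j) / m.real 24 (m.nat 3)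
      else 0) := by
  rw [scoreProg, Prog.run_seq, Prog.run_seq, Prog.run_natConst]
  have hdot := run_dotProg (O := O) (a := 23) (b := 2) (by decide) (by decide)
    (m := m.setNat 6 1) (by simpa [Mem.setNat] using h4)
  have hreal : ∀ a, (dotProg 23 2).writesArr a = false →
      ((dotProg 23 2).run O (m.setNat 6 1)).real a = m.real a := fun a h =>
    Prog.run_real_eq _ h _
  have hnat : ∀ i, (dotProg 23 2).writesReg i = false →
      ((dotProg 23 2).run O (m.setNat 6 1)).nat i = (m.setNat 6 1).nat i := fun i h =>
    Prog.run_nat_eq _ h _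
  have h20 := hreal 20 rfl
  have h24 := hreal 24 rfl
  have h12 := hreal 12 rfl
  have h15 := hreal 15 rfl
  have h1 := hreal 1 rfl
  have n3 := hnat 3 rfl
  have n4 := hnat 4 rfl
  have n6 := hnat 6 rfl
  set m' := (dotProg 23 2).run O (m.setNat 6 1)
  simp [Mem.setNat] at hdot n3 n4 n6
  simp only [Prog.run_seq, Prog.run_arith]
  simp [Mem.set, Mem.get, Mem.setReal, scalar, h20, h24, h12, h15, h1, n3, n4, n6, h4, hdot,
    BinOp.eval, Function.update_apply]
  split_ifs with hk
  · rw [hk]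
  · rw [add_zero]

theorem run_loadProg {m : Mem} {j : ℕ} (hj : j < m.nat 1) :
    (loadProg.run O m).real 21 j = m.real 21 j + m.real 2 j := by
  have := Prog.run_forLoop_induction (O := O) (i := 5) (j := 1)
    (P := .arith .add (entry 21) (entry 21) (entry 2)) (m := m)
    (I := fun k m' => m'.real 2 = m.real 2 ∧ (∀ j < k, m'.real 21 j = m.real 21 j + m.real 2 j) ∧
      ∀ j, k ≤ j → m'.real 21 j = m.real 21 j) (by simp) ?_
  · exact this.2.1 j hj
  · rintro k _ m' ⟨h2, h1, h3⟩
    rw [Prog.run_arith]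
    refine ⟨by simp [Mem.set, Mem.setReal, Mem.setNat, entry, h2], fun i hi => ?_, fun i hi => ?_⟩
    · rcases Nat.lt_succ_iff_lt_or_eq.1 hi with h | rfl
      · simp [Mem.set, Mem.get, Mem.setReal, Mem.setNat, entry, Function.update_of_ne h.ne, h1 i h]
      · simp [Mem.set, Mem.get, Mem.setReal, Mem.setNat, entry, h3, h2, BinOp.eval]
    · have : i ≠ k := by omega
      simp [Mem.set, Mem.get, Mem.setReal, Mem.setNat, entry, Function.update_of_ne this,
        h3 i (by omega)]

theorem run_spendProg {m : Mem} (h4 : m.nat 4 = 0) (h1 : m.nat 1 = d) :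
    (spendProg.run O m).real 22 0 = m.real 22 0
      + ∑ j : Fin d, O (m.real 10 0) (fun j => m.real 21 j) j * m.real 2 j := by
  rw [spendProg, Prog.run_seq, Prog.run_seq, Prog.run_grad]
  set m' := m.setVec 33 (O (m.get (scalar 10)) fun j => m.real 21 j) with hm'
  have hdot := run_dotProg (O := O) (a := 33) (b := 2) (by decide) (by decide) (m := m') h4
  have h22 : ((dotProg 33 2).run O m').real 22 = m.real 22 := Prog.run_real_eq _ rfl _
  have n4 : ((dotProg 33 2).run O m').nat 4 = m.nat 4 := Prog.run_nat_eq _ rfl _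
  rw [Prog.run_arith]
  have e1 : m'.nat 1 = d := h1
  rw [e1, Finset.sum_range] at hdot
  simp only [Mem.set, Mem.get, Mem.setReal, scalar, n4, h4, BinOp.eval, h22, hdot,
    Function.update_self]
  congr 1
  refine Finset.sum_congr rfl fun j _ => ?_
  simp [hm', Mem.setVec, Mem.get, scalar, h4]

theorem run_priceProg {m : Mem} (h4 : m.nat 4 = 0) (h1 : m.nat 1 = d) (h16 : m.real 16 0 = 1)
    (j : Fin d) : (priceProg.run O m).real 23 j
      = O (m.real 10 0) ((fun j : Fin d => m.real 21 j) + 1) j := by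
  rw [priceProg, Prog.run_seq, Prog.run_grad]
  have := Prog.run_forLoop_induction (O := O) (i := 5) (j := 1)
    (P := .arith .add (entry 34) (entry 21) (scalar 16)) (m := m)
    (I := fun k m' => m'.real 21 = m.real 21 ∧ m'.real 16 = m.real 16 ∧ m'.nat 4 = 0 ∧
      m'.real 10 = m.real 10 ∧ ∀ j < k, m'.real 34 j = m.real 21 j + 1) (by simp [h4]) ?_
  · set m' := Prog.run O (.forLoop 5 1 (.arith .add (entry 34) (entry 21) (scalar 16))) m
    obtain ⟨e1, e2, e3, e4, e5⟩ := this
    simp only [Mem.setVec, Function.update_self, j.2, dif_pos, Mem.get, scalar, e3, e4]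
    congr 1
    ext i
    rw [e5 i (by rw [h1]; exact i.2)]
    rfl
  · rintro k _ m' ⟨e1, e2, e3, e4, e5⟩
    rw [Prog.run_arith]
    refine ⟨by simp [Mem.set, Mem.setReal, Mem.setNat, entry, e1],
      by simp [Mem.set, Mem.setReal, Mem.setNat, entry, e2],
      by simp [Mem.set, Mem.setReal, Mem.setNat, e3],
      by simp [Mem.set, Mem.setReal, Mem.setNat, entry, e4], fun i hi => ?_⟩
    rcases Nat.lt_succ_iff_lt_or_eq.1 hi with h | rfl
    · simp [Mem.set, Mem.get, Mem.setReal, Mem.setNat, entry, Function.update_of_ne h.ne, e5 i h]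
    · simp [Mem.set, Mem.get, Mem.setReal, Mem.setNat, entry, scalar, e1, e2, e3, h16, BinOp.eval]

theorem run_weightProg {m : Mem} (h4 : m.nat 4 = 0) :
    (∀ k < m.nat 0, (weightProg.run O m).real 24 k = Real.exp (m.real 20 k)) ∧
      (weightProg.run O m).real 35 0 = ∑ k ∈ Finset.range (m.nat 0), Real.exp (m.real 20 k) := by
  rw [weightProg, Prog.run_seq, Prog.run_arith]
  set m₁ := m.set (scalar 35) (BinOp.sub.eval (m.get (scalar 35)) (m.get (scalar 35))) with hm₁
  have := Prog.run_forLoop_induction (O := O) (i := 5) (j := 0)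
    (P := .seq (.exp (entry 24) (entry 20))
      (.arith .add (scalar 35) (scalar 35) (entry 24))) (m := m₁)
    (I := fun k m' => m'.real 20 = m.real 20 ∧ m'.nat 4 = 0 ∧
      (∀ j < k, m'.real 24 j = Real.exp (m.real 20 j)) ∧
      m'.real 35 0 = ∑ j ∈ Finset.range k, Real.exp (m.real 20 j)) ?_ ?_
  · exact this.2.2
  · simp [hm₁, Mem.set, Mem.get, Mem.setReal, scalar, h4, BinOp.eval]
  · rintro k _ m' ⟨e1, e2, e3, e4⟩
    rw [Prog.run_seq, Prog.run_exp, Prog.run_arith]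
    refine ⟨by simp [Mem.set, Mem.setReal, Mem.setNat, entry, scalar, e1],
      by simp [Mem.set, Mem.setReal, Mem.setNat, e2], fun i hi => ?_, ?_⟩
    · rcases Nat.lt_succ_iff_lt_or_eq.1 hi with h | rfl
      · simp [Mem.set, Mem.get, Mem.setReal, Mem.setNat, entry, scalar,
          Function.update_of_ne h.ne, e3 i h]
      · simp [Mem.set, Mem.get, Mem.setReal, Mem.setNat, entry, scalar, e1]
    · rw [Finset.sum_range_succ, ← e4]
      simp [Mem.set, Mem.get, Mem.setReal, Mem.setNat, entry, scalar, e1, e2, BinOp.eval]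

theorem run_sampleProg {m : Mem} (h4 : m.nat 4 = 0) {n : ℕ} (h0 : m.nat 0 = n) {l : ℕ → ℝ}
    (h24 : ∀ k < n, m.real 24 k = Real.exp (l k))
    (h35 : m.real 35 0 = ∑ k ∈ Finset.range n, Real.exp (l k)) :
    (sampleProg.run O m).nat 3
        = sampleArm n (m.real 13 0) (m.real 14 0) (armProb n l) (m.real 1 0) ∧
      (∀ k, (sampleProg.run O m).real 20 k = m.real 20 k
        + if k < n ∧ armProb n l k < m.real 13 0 then m.real 17 0 else 0) ∧
      ∀ k < n, (sampleProg.run O m).real 24 k = armProb n l k := by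
  rw [sampleProg, Prog.run_seq, Prog.run_seq, Prog.run_seq, Prog.run_arith, Prog.run_natConst]
  set m₁ := (m.set (scalar 36) (BinOp.sub.eval (m.get (scalar 36)) (m.get (scalar 36)))).setNat 3 0
    with hm₁
  set body : Prog := .seq (.arith .div (entry 24) (entry 24) (scalar 35))
    (.ifLe (scalar 13) (entry 24)
      (.seq (.ifLe (scalar 36) (scalar 1) (.natAdd 3 5 4) (.natConst 7 0))
        (.seq (.arith .mul (scalar 37) (scalar 14) (entry 24))
          (.arith .add (scalar 36) (scalar 36) (scalar 37))))
      (.arith .add (entry 20) (entry 20) (scalar 17))) with hbody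
  set c := m.real 13 0 with hc
  set s := m.real 14 0 with hs
  set u := m.real 1 0 with hu
  set q := armProb n l with hq
  have hloop := Prog.run_forLoop_induction (O := O) (i := 5) (j := 0) (P := body) (m := m₁)
    (I := fun k m' => m'.real 35 = m.real 35 ∧ m'.real 13 = m.real 13 ∧ m'.real 14 = m.real 14 ∧
      m'.real 1 = m.real 1 ∧ m'.real 17 = m.real 17 ∧ m'.nat 4 = 0 ∧
      m'.nat 3 = pickArm c s q u k ∧ m'.real 36 0 = cumProb c s q k ∧
      (∀ j, m'.real 20 j = m.real 20 j + if j < k ∧ q j < c then m.real 17 0 else 0) ∧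
      (∀ j < k, m'.real 24 j = q j) ∧ ∀ j, k ≤ j → m'.real 24 j = m.real 24 j) ?_ ?_
  · set m₂ := Prog.run O (.forLoop 5 0 body) m₁
    have hn : m₁.nat 0 = n := by simp [hm₁, Mem.set, Mem.setReal, Mem.setNat, h0]
    rw [hn] at hloop
    obtain ⟨-, -, -, e1, -, e4, e3, e36, e20, e24, -⟩ := hloop
    have hg36 : m₂.get (scalar 36) = cumProb c s q n := by
      simp [Mem.get, scalar, e4, e36]
    have hg1 : m₂.get (scalar 1) = u := by simp [Mem.get, scalar, e4, e1, hu]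
    rw [Prog.run_ifLe, hg36, hg1, Prog.run_natConst, Prog.run_natConst, sampleArm]
    split_ifs
    · exact ⟨by simp [Mem.setNat], e20, e24⟩
    · exact ⟨by simp [Mem.setNat, e3], e20, e24⟩
  · refine ⟨?_, ?_, ?_, ?_, ?_, ?_, ?_, ?_, ?_, ?_, ?_⟩ <;>
      simp [hm₁, Mem.set, Mem.get, Mem.setReal, Mem.setNat, scalar, h4, BinOp.eval, pickArm,
        cumProb]
  · rintro k hk m' ⟨e35, e13, e14, e1, e17, e4, e3, e36, e20, e24, e24'⟩
    have hkn : k < n := by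
      have hn : m₁.nat 0 = n := by simp [hm₁, Mem.set, Mem.setReal, Mem.setNat, h0]
      omega
    have hfr : ∀ a, body.writesArr a = false →
        (body.run O (m'.setNat 5 k)).real a = m'.real a := fun a h => Prog.run_real_eq _ h _
    have hfn : (body.run O (m'.setNat 5 k)).nat 4 = m'.nat 4 := Prog.run_nat_eq _ rfl _
    refine ⟨(hfr 35 rfl).trans e35, (hfr 13 rfl).trans e13, (hfr 14 rfl).trans e14,
      (hfr 1 rfl).trans e1, (hfr 17 rfl).trans e17, hfn.trans e4, ?_⟩
    rw [hbody, Prog.run_seq, Prog.run_arith]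
    set m₃ := (m'.setNat 5 k).set (entry 24)
      (BinOp.div.eval ((m'.setNat 5 k).get (entry 24)) ((m'.setNat 5 k).get (scalar 35))) with hm₃
    have f24 : m₃.real 24 k = q k := by
      simp [hm₃, Mem.set, Mem.get, Mem.setReal, Mem.setNat, scalar, entry, e4, e35, h35,
        BinOp.eval, e24' k le_rfl, h24 k hkn, hq, armProb]
    have f24a : ∀ j, j ≠ k → m₃.real 24 j = m'.real 24 j := fun j hj => by
      simp [hm₃, Mem.set, Mem.get, Mem.setReal, Mem.setNat, entry, Function.update_of_ne hj]
    have fr : ∀ a, a ≠ 24 → m₃.real a = m'.real a := fun a ha => by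
      simp [hm₃, Mem.set, Mem.setReal, Mem.setNat, entry, Function.update_of_ne ha]
    have f3 : m₃.nat 3 = m'.nat 3 := by simp [hm₃, Mem.set, Mem.setReal, Mem.setNat]
    have f4 : m₃.nat 4 = 0 := by simp [hm₃, Mem.set, Mem.setReal, Mem.setNat, e4]
    have f5 : m₃.nat 5 = k := by simp [hm₃, Mem.set, Mem.setReal, Mem.setNat]
    have g13 : m₃.get (scalar 13) = c := by
      simp [Mem.get, scalar, f4, fr 13 (by decide), e13, hc]
    have g24 : m₃.get (entry 24) = q k := by simp [Mem.get, entry, f5, f24]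
    have g36 : m₃.get (scalar 36) = cumProb c s q k := by
      simp [Mem.get, scalar, f4, fr 36 (by decide), e36]
    have g1 : m₃.get (scalar 1) = u := by
      simp [Mem.get, scalar, f4, fr 1 (by decide), e1, hu]
    have hall24 : ∀ j < k + 1, m₃.real 24 j = q j := fun j hj => by
      rcases Nat.lt_succ_iff_lt_or_eq.1 hj with h | rfl
      · rw [f24a j h.ne, e24 j h]
      · exact f24
    have hall24' : ∀ j, k + 1 ≤ j → m₃.real 24 j = m.real 24 j := fun j hj => by
      rw [f24a j (by omega), e24' j (by omega)]
    rw [Prog.run_ifLe, g13, g24]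
    by_cases hcq : c ≤ q k
    · rw [if_pos hcq, Prog.run_seq, Prog.run_ifLe, g36, g1, Prog.run_natAdd, Prog.run_natConst]
      have h20' : ∀ j, m'.real 20 j
          = m.real 20 j + if j < k + 1 ∧ q j < c then m.real 17 0 else 0 := by
        intro j
        rw [e20 j]
        have : (j < k ∧ q j < c) ↔ (j < k + 1 ∧ q j < c) := by
          constructor
          · exact fun h => ⟨by omega, h.2⟩
          · rintro ⟨h1, h2⟩
            refine ⟨?_, h2⟩
            rcases Nat.lt_succ_iff_lt_or_eq.1 h1 with h | rfl
            · exact h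
            · exact absurd hcq (not_le.2 h2)
        simp only [this]
      have hcum : cumProb c s q (k + 1) = cumProb c s q k + s * q k := by
        rw [cumProb_succ, playProb, if_pos hcq]
      have hcs : m'.real 14 0 = s := by rw [e14]
      simp only [Prog.run_seq, Prog.run_arith]
      by_cases hcu : cumProb c s q k ≤ u
      · rw [if_pos hcu, pickArm, if_pos ⟨hcq, hcu⟩]
        refine ⟨?_, ?_, fun j => ?_, fun j hj => ?_, fun j hj => ?_⟩
        · simp [Mem.set, Mem.setReal, Mem.setNat, f4, f5]
        · rw [hcum]
          simp [Mem.set, Mem.get, Mem.setReal, Mem.setNat, scalar, entry, f4, f5, f24, BinOp.eval,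
            fr, e36, hcs]
        · simp [Mem.set, Mem.get, Mem.setReal, Mem.setNat, scalar, fr, h20']
        · simpa [Mem.set, Mem.get, Mem.setReal, Mem.setNat, scalar] using hall24 j hj
        · simpa [Mem.set, Mem.get, Mem.setReal, Mem.setNat, scalar] using hall24' j hj
      · rw [if_neg hcu, pickArm, if_neg (fun h => hcu h.2)]
        refine ⟨?_, ?_, fun j => ?_, fun j hj => ?_, fun j hj => ?_⟩
        · simp [Mem.set, Mem.setReal, Mem.setNat, f3, e3]
        · rw [hcum]
          simp [Mem.set, Mem.get, Mem.setReal, Mem.setNat, scalar, entry, f4, f5, f24, BinOp.eval,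
            fr, e36, hcs]
        · simp [Mem.set, Mem.get, Mem.setReal, Mem.setNat, scalar, fr, h20']
        · simpa [Mem.set, Mem.get, Mem.setReal, Mem.setNat, scalar] using hall24 j hj
        · simpa [Mem.set, Mem.get, Mem.setReal, Mem.setNat, scalar] using hall24' j hj
    · rw [if_neg hcq, Prog.run_arith, pickArm, if_neg (fun h => hcq h.1), cumProb_succ, playProb,
        if_neg hcq, add_zero]
      refine ⟨?_, ?_, fun j => ?_, fun j hj => ?_, fun j hj => ?_⟩
      · simp [Mem.set, Mem.setReal, f3, e3]
      · simp [Mem.set, Mem.get, Mem.setReal, entry, fr, e36]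
      · by_cases hjk : j = k
        · subst hjk
          push Not at hcq
          simp [Mem.set, Mem.get, Mem.setReal, entry, scalar, fr, f5, f4, BinOp.eval, e20, e17,
            hcq]
        · have : (j < k + 1 ∧ q j < c) ↔ (j < k ∧ q j < c) := by
            constructor
            · exact fun h => ⟨by omega, h.2⟩
            · exact fun h => ⟨by omega, h.2⟩
          simp only [this]
          simp [Mem.set, Mem.get, Mem.setReal, entry, fr, f5, Function.update_of_ne hjk, e20]
      · simpa [Mem.set, Mem.get, Mem.setReal, entry] using hall24 j hj
      · simpa [Mem.set, Mem.get, Mem.setReal, entry] using hall24' j hj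

end Specs

/-- Store the natural number `v` in scalar `k`. -/
def litProg (k v : ℕ) : Prog := .seq (.natConst 5 v) (.cast (scalar k) 5)

/-- Copy entry `k` of the input array into scalar `z` (scalar `31` is `0`). -/
def inputProg (z k : ℕ) : Prog :=
  .seq (.natConst 5 k) (.arith .add (scalar z) ⟨0, 5⟩ (scalar 31))

/-- An arithmetic operation on scalars. -/
def opProg (op : BinOp) (z x y : ℕ) : Prog := .arith op (scalar z) (scalar x) (scalar y)

/-- The program run before the first round: the scalars `10, …, 17` receive the parameters, the
number `1`, and the product of the learning rate and the mixing fraction. -/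
def setupProg : Prog :=
  .seq (inputProg 40 0) <| .seq (inputProg 41 1) <| .seq (inputProg 42 2) <|
  .seq (inputProg 43 3) <| .seq (inputProg 44 4) <| .seq (opProg .add 45 42 43) <|
  -- the scale
  .seq (litProg 46 200) <| .seq (opProg .mul 46 46 45) <| .seq (opProg .div 10 46 40) <|
  -- the threshold
  .seq (litProg 46 2) <| .seq (opProg .div 46 40 46) <| .seq (opProg .div 47 43 10) <|
  .seq (opProg .sub 11 46 47) <|
  -- the price
  .seq (litProg 46 2000) <| .seq (opProg .mul 47 45 40) <| .seq (opProg .mul 47 46 47) <|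
  .seq (opProg .div 12 44 47) <|
  -- the cutoff
  .seq (.cast (scalar 46) 0) <| .seq (.cast (scalar 47) 2) <| .seq (opProg .mul 46 46 47) <|
  .seq (litProg 47 100) <| .seq (opProg .mul 46 47 46) <| .seq (opProg .div 13 44 46) <|
  -- the mixing fraction
  .seq (litProg 46 20000) <| .seq (opProg .mul 46 46 45) <| .seq (litProg 16 1) <|
  .seq (opProg .div 14 16 46) <|
  -- the learning rate
  .seq (.cast (scalar 46) 0) <| .seq (opProg .div 46 46 41) <|
  .seq (.log (scalar 46) (scalar 46)) <| .seq (opProg .mul 46 45 46) <|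
  .seq (litProg 47 1000000) <| .seq (opProg .mul 46 47 46) <| .seq (opProg .div 15 46 44)
    (opProg .mul 17 15 14)

/-! ### The program follows the algorithm -/

/-- The memory `m` holds the registers and parameters the program of a round relies on. -/
structure Mem.Ready (n d : ℕ) (P : LearnerParams) (m : Mem) : Prop where
  nat_zero : m.nat 0 = n
  nat_one : m.nat 1 = d
  nat_four : m.nat 4 = 0
  scale : m.real 10 0 = P.scale
  threshold : m.real 11 0 = P.threshold
  price : m.real 12 0 = P.price
  cutoff : m.real 13 0 = P.cutoff
  mix : m.real 14 0 = P.mix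
  rate : m.real 15 0 = P.rate
  one : m.real 16 0 = 1
  rate_mix : m.real 17 0 = P.rate * P.mix

/-- The memory `m` represents the state `st`, where the feedback of the last round is still to be
processed. -/
structure Mem.Represents {n d : ℕ} (P : LearnerParams) (G : (Fin d → ℝ) → Fin d → ℝ) (m : Mem)
    (st : LearnerState n d) : Prop where
  ready : m.Ready n d P
  logw : ∀ k, m.real 20 k + (if k = m.nat 3 then P.rate * (m.real 1 1 - P.price
    * ∑ j : Fin d, m.real 23 j * m.real 2 j) / m.real 24 (m.nat 3) else 0) = st.logw k
  load : ∀ j : Fin d, m.real 21 j + m.real 2 j = st.load j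
  spent : m.real 22 0 + ∑ j : Fin d, G st.load j * m.real 2 j = st.spent

section Execution

variable {n d : ℕ} {P : LearnerParams} {O : ℝ → (Fin d → ℝ) → Fin d → ℝ}

theorem Mem.Ready.run {m : Mem} (h : m.Ready n d P) {Q : Prog}
    (hQ : ∀ r ∈ [0, 1, 4], Q.writesReg r = false)
    (hQ' : ∀ a ∈ [10, 11, 12, 13, 14, 15, 16, 17], Q.writesArr a = false) :
    (Q.run O m).Ready n d P := by
  constructor
  · rw [Prog.run_nat_eq Q (hQ 0 (by simp))]; exact h.nat_zero
  · rw [Prog.run_nat_eq Q (hQ 1 (by simp))]; exact h.nat_one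
  · rw [Prog.run_nat_eq Q (hQ 4 (by simp))]; exact h.nat_four
  · rw [Prog.run_real_eq Q (hQ' 10 (by simp))]; exact h.scale
  · rw [Prog.run_real_eq Q (hQ' 11 (by simp))]; exact h.threshold
  · rw [Prog.run_real_eq Q (hQ' 12 (by simp))]; exact h.price
  · rw [Prog.run_real_eq Q (hQ' 13 (by simp))]; exact h.cutoff
  · rw [Prog.run_real_eq Q (hQ' 14 (by simp))]; exact h.mix
  · rw [Prog.run_real_eq Q (hQ' 15 (by simp))]; exact h.rate
  · rw [Prog.run_real_eq Q (hQ' 16 (by simp))]; exact h.one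
  · rw [Prog.run_real_eq Q (hQ' 17 (by simp))]; exact h.rate_mix

theorem setupProg_ready (d T : ℕ) (O : ℝ → (Fin d → ℝ) → Fin d → ℝ) (B p α γ opt : ℝ) :
    (setupProg.run O (initMem n d T B p α γ opt)).Ready n d (learnerParams n T B p α γ opt) := by
  constructor <;>
  simp [setupProg, inputProg, litProg, opProg, Prog.run_seq, Prog.run_natConst, Prog.run_cast,
    Prog.run_arith, Prog.run_log, initMem, Mem.set, Mem.get, Mem.setReal, Mem.setNat, scalar,
    BinOp.eval, learnerParams]

theorem setupProg_represents (d T : ℕ) (O : ℝ → (Fin d → ℝ) → Fin d → ℝ) (B p α γ opt : ℝ)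
    (G : (Fin d → ℝ) → Fin d → ℝ) :
    (setupProg.run O (initMem n d T B p α γ opt)).Represents (n := n)
      (learnerParams n T B p α γ opt) G (initState n d) := by
  have h := fun a ha => congrFun (Prog.run_real_eq (O := O) (a := a) setupProg ha
    (initMem n d T B p α γ opt))
  have h1 := h 1 rfl
  have h2 := h 2 rfl
  have h20 := h 20 rfl
  have h21 := h 21 rfl
  have h22 := h 22 rfl
  have h24 := h 24 rfl
  refine ⟨setupProg_ready d T O B p α γ opt, fun k => ?_, fun j => ?_, ?_⟩
  · rw [h20, h24]; simp [initMem, initState]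
  · rw [h21, h2]; simp [initMem, initState]
  · simp only [h22, h2]; simp [initMem, initState]

/-- The memory after the program of a round, before the feedback: the feedback of the previous round
has been processed, the action has been selected, and the prices and weights needed to process the
next feedback are stored. -/
theorem run_roundProg {m : Mem} {st : LearnerState n d} (h : m.Represents P (O P.scale) st)
    (u : ℝ) :
    ((roundProg.run O (m.setReal 1 0 u)).Ready n d P) ∧
    (roundProg.run O (m.setReal 1 0 u)).nat 3 = nextAction P st u ∧
    (∀ j : Fin d, (roundProg.run O (m.setReal 1 0 u)).real 21 j = st.load j) ∧
    (roundProg.run O (m.setReal 1 0 u)).real 22 0 = st.spent ∧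
    (∀ j : Fin d, (roundProg.run O (m.setReal 1 0 u)).real 23 j = O P.scale (st.load + 1) j) ∧
    (∀ k, (roundProg.run O (m.setReal 1 0 u)).real 20 k = st.logw k
      + if st.spent ≤ P.threshold ∧ k < n ∧ armProb n st.logw k < P.cutoff
        then P.rate * P.mix else 0) ∧
    (st.spent ≤ P.threshold → ∀ k < n,
      (roundProg.run O (m.setReal 1 0 u)).real 24 k = armProb n st.logw k) := by
  set m₀ := m.setReal 1 0 u with hm₀
  have hr : ∀ a, a ≠ 1 → m₀.real a = m.real a := fun a ha => by
    simp [hm₀, Mem.setReal, Function.update_of_ne ha]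
  have hn : m₀.nat = m.nat := rfl
  have h11 : m₀.real 1 1 = m.real 1 1 := by simp [hm₀, Mem.setReal]
  have h10 : m₀.real 1 0 = u := by simp [hm₀, Mem.setReal]
  have R0 : m₀.Ready n d P := by
    have := h.ready
    constructor <;> simp only [hn, hr, ne_eq, OfNat.ofNat_ne_one, not_false_eq_true]
    exacts [this.1, this.2, this.3, this.4, this.5, this.6, this.7, this.8, this.9, this.10,
      this.11]
  rw [roundProg]
  simp only [Prog.run_seq]
  have s20 := run_scoreProg (O := O) R0.nat_four
  have R1 : (scoreProg.run O m₀).Ready n d P := R0.run (by decide) (by decide)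
  have a1 : ∀ a, scoreProg.writesArr a = false → (scoreProg.run O m₀).real a = m₀.real a :=
    fun a ha => Prog.run_real_eq _ ha _
  have a1_1 := a1 1 rfl
  have a1_2 := a1 2 rfl
  have a1_21 := a1 21 rfl
  have a1_22 := a1 22 rfl
  set m₁ := scoreProg.run O m₀ with hm₁
  have l1 : ∀ k, m₁.real 20 k = st.logw k := by
    intro k
    rw [s20, ← h.logw k, hr 20 (by decide), R0.rate, R0.price, R0.nat_one, Finset.sum_range, h11,
      hr 23 (by decide), hr 2 (by decide), hr 24 (by decide), hn]
  have s21 := fun j hj => run_loadProg (O := O) (m := m₁) (j := j) hj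
  have R2 : (loadProg.run O m₁).Ready n d P := R1.run (by decide) (by decide)
  have a2 : ∀ a, loadProg.writesArr a = false → (loadProg.run O m₁).real a = m₁.real a :=
    fun a ha => Prog.run_real_eq _ ha _
  have a2_1 := a2 1 rfl
  have a2_2 := a2 2 rfl
  have a2_20 := a2 20 rfl
  have a2_22 := a2 22 rfl
  set m₂ := loadProg.run O m₁ with hm₂
  have l2 : ∀ j : Fin d, m₂.real 21 j = st.load j := by
    intro j
    rw [s21 j (by rw [R1.nat_one]; exact j.2), a1_21, a1_2, hr 21 (by decide), hr 2 (by decide)]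
    exact h.load j
  have l2' : (fun j : Fin d => m₂.real 21 j) = st.load := funext l2
  have s22 := run_spendProg (O := O) R2.nat_four R2.nat_one
  have R3 : (spendProg.run O m₂).Ready n d P := R2.run (by decide) (by decide)
  have a3 : ∀ a, spendProg.writesArr a = false → (spendProg.run O m₂).real a = m₂.real a :=
    fun a ha => Prog.run_real_eq _ ha _
  have a3_1 := a3 1 rfl
  have a3_20 := a3 20 rfl
  have a3_21 := a3 21 rfl
  set m₃ := spendProg.run O m₂ with hm₃
  have l3 : m₃.real 22 0 = st.spent := by
    rw [s22, l2', R2.scale, a2_22, a1_22, a2_2, a1_2, hr 22 (by decide), hr 2 (by decide)]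
    exact h.spent
  have s23 := fun j => run_priceProg (O := O) R3.nat_four R3.nat_one R3.one j
  have R4 : (priceProg.run O m₃).Ready n d P := R3.run (by decide) (by decide)
  have a4 : ∀ a, priceProg.writesArr a = false → (priceProg.run O m₃).real a = m₃.real a :=
    fun a ha => Prog.run_real_eq _ ha _
  have a4_1 := a4 1 rfl
  have a4_20 := a4 20 rfl
  have a4_21 := a4 21 rfl
  have a4_22 := a4 22 rfl
  set m₄ := priceProg.run O m₃ with hm₄
  have l4_23 : ∀ j : Fin d, m₄.real 23 j = O P.scale (st.load + 1) j := by
    intro j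
    rw [s23 j, R3.scale, a3_21, l2']
  have l4_20 : ∀ k, m₄.real 20 k = st.logw k := fun k => by
    rw [a4_20, a3_20, a2_20]; exact l1 k
  have l4_21 : ∀ j : Fin d, m₄.real 21 j = st.load j := fun j => by
    rw [a4_21, a3_21]; exact l2 j
  have l4_22 : m₄.real 22 0 = st.spent := by rw [a4_22]; exact l3
  have l4_1 : m₄.real 1 0 = u := by rw [a4_1, a3_1, a2_1, a1_1]; exact h10
  have g22 : m₄.get (scalar 22) = st.spent := by
    simp only [Mem.get, scalar, R4.nat_four]; exact l4_22
  have g11 : m₄.get (scalar 11) = P.threshold := by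
    simp only [Mem.get, scalar, R4.nat_four]; exact R4.threshold
  rw [Prog.run_ifLe, g22, g11, nextAction]
  by_cases hact : st.spent ≤ P.threshold
  · simp only [if_pos hact, Prog.run_seq]
    obtain ⟨w24, w35⟩ := run_weightProg (O := O) R4.nat_four
    have R5 : (weightProg.run O m₄).Ready n d P := R4.run (by decide) (by decide)
    have a5 : ∀ a, weightProg.writesArr a = false → (weightProg.run O m₄).real a = m₄.real a :=
      fun a ha => Prog.run_real_eq _ ha _
    have a5_1 := a5 1 rfl
    have a5_20 := a5 20 rfl
    have a5_21 := a5 21 rfl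
    have a5_22 := a5 22 rfl
    have a5_23 := a5 23 rfl
    set m₅ := weightProg.run O m₄ with hm₅
    simp only [R4.nat_zero, l4_20] at w24 w35
    obtain ⟨s3, s20', s24⟩ := run_sampleProg (O := O) R5.nat_four R5.nat_zero w24 w35
    have a6 : ∀ a, sampleProg.writesArr a = false → (sampleProg.run O m₅).real a = m₅.real a :=
      fun a ha => Prog.run_real_eq _ ha _
    have a6_21 := a6 21 rfl
    have a6_22 := a6 22 rfl
    have a6_23 := a6 23 rfl
    refine ⟨R5.run (by decide) (by decide), ?_, fun j => ?_, ?_, fun j => ?_, fun k => ?_,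
      fun _ => s24⟩
    · rw [s3, R5.cutoff, R5.mix, a5_1, l4_1]
    · rw [a6_21, a5_21]; exact l4_21 j
    · rw [a6_22, a5_22]; exact l4_22
    · rw [a6_23, a5_23]; exact l4_23 j
    · rw [s20' k, a5_20, l4_20, R5.cutoff, R5.rate_mix]
      simp only [hact, true_and]
  · simp only [if_neg hact]
    refine ⟨R4.run (by decide) (by decide), ?_, fun j => ?_, ?_, fun j => ?_, fun k => ?_,
      fun h => absurd h hact⟩
    · rw [Prog.run_natConst]; simp [Mem.setNat]
    · rw [Prog.run_natConst]; exact l4_21 j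
    · rw [Prog.run_natConst]; exact l4_22
    · rw [Prog.run_natConst]; exact l4_23 j
    · rw [Prog.run_natConst]
      simp only [hact, false_and, if_false, add_zero]
      exact l4_20 k

variable [NeZero n]

theorem nextAction_lt (st : LearnerState n d) (u : ℝ) : nextAction P st u < n := by
  unfold nextAction
  split_ifs
  · rcases sampleArm_eq_zero_or (n := n) (cutoff := P.cutoff) (mix := P.mix)
      (p := armProb n st.logw) u with h | h
    · rw [h]; exact NeZero.pos n
    · exact h.1
  · exact NeZero.pos n

/-- One round of play: the memory keeps representing the state. -/
theorem represents_round {m : Mem} {st : LearnerState n d} (h : m.Represents P (O P.scale) st)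
    (u : ℝ) {r : Fin n → ℝ} {C : Matrix (Fin d) (Fin n) ℝ} (hround : IsRound r C) :
    (((roundProg.run O (m.setReal 1 0 u)).setReal 1 1 (r (actionOf n (nextAction P st u)))).setVec 2
      fun j => C j (actionOf n (nextAction P st u))).Represents P (O P.scale)
      (nextState P (O P.scale) r C st (nextAction P st u)) := by
  obtain ⟨R, f3, f21, f22, f23, f20, f24⟩ := run_roundProg h u
  set a := nextAction P st u with ha
  set i := actionOf n a with hi
  set m' := roundProg.run O (m.setReal 1 0 u) with hm'
  set m'' := (m'.setReal 1 1 (r i)).setVec 2 fun j => C j i with hm''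
  have hn : m''.nat = m'.nat := rfl
  have hr : ∀ b, b ≠ 1 → b ≠ 2 → m''.real b = m'.real b := fun b hb hb' => by
    simp [hm'', Mem.setVec, Mem.setReal, Function.update_of_ne hb, Function.update_of_ne hb']
  have h1 : m''.real 1 1 = r i := by simp [hm'', Mem.setVec, Mem.setReal]
  have h2 : ∀ j : Fin d, m''.real 2 j = C j i := fun j => by simp [hm'', Mem.setVec]
  have R' : m''.Ready n d P := by
    constructor <;> simp only [hn, hr, ne_eq, OfNat.ofNat_ne_one, not_false_eq_true,
      Nat.reduceEqDiff]
    exacts [R.1, R.2, R.3, R.4, R.5, R.6, R.7, R.8, R.9, R.10, R.11]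
  by_cases hact : st.spent ≤ P.threshold
  · rw [nextState_of_le hact]
    refine ⟨R', fun k => ?_, fun j => ?_, ?_⟩
    · rw [hr 20 (by decide) (by decide), f20 k, hn, f3, h1, hr 23 (by decide) (by decide),
        hr 24 (by decide) (by decide), f24 hact a (nextAction_lt st u)]
      simp only [hact, true_and, h2, f23, colCost]
      rfl
    · rw [hr 21 (by decide) (by decide), f21, h2]; rfl
    · rw [hr 22 (by decide) (by decide), f22]
      simp only [h2]
      rfl
  · have ha0 : a = 0 := by rw [ha, nextAction, if_neg hact]
    have hi0 : i = 0 := by rw [hi, ha0, actionOf_zero]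
    have hc : ∀ j : Fin d, m''.real 2 j = 0 := fun j => by rw [h2, hi0, hround.null_cost]
    have hr0 : m''.real 1 1 = 0 := by rw [h1, hi0, hround.null_reward]
    rw [nextState_of_lt hact]
    refine ⟨R', fun k => ?_, fun j => ?_, ?_⟩
    · simp only [hc, hr0]
      rw [hr 20 (by decide) (by decide), f20 k]
      simp [hact]
    · rw [hc, hr 21 (by decide) (by decide), f21, add_zero]
    · simp only [hc]
      rw [hr 22 (by decide) (by decide), f22]
      simp

/-- The algorithm for Bandits with Knapsacks, as a program. -/
def knapsackAlg : BanditAlg where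
  setup := setupProg
  step := roundProg

theorem setupProg_timeBound (n d : ℕ) : setupProg.timeBound n d ≤ 100 := by
  simp [setupProg, inputProg, litProg, opProg, Prog.timeBound]

theorem roundProg_timeBound (n d : ℕ) : roundProg.timeBound n d ≤ 100 * (n + d + 1) := by
  simp [roundProg, scoreProg, loadProg, spendProg, priceProg, weightProg, sampleProg, dotProg,
    Prog.timeBound]
  omega

/-- The play of the program follows the trajectory of the algorithm. -/
theorem play_knapsackAlg {T : ℕ} {B p α γ opt : ℝ} {r : ℕ → Fin n → ℝ}
    {C : ℕ → Matrix (Fin d) (Fin n) ℝ} (hround : ∀ t < T, IsRound (r t) (C t))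
    (ω : ℕ → unitInterval) : ∀ t ≤ T,
    (play knapsackAlg O (initMem n d T B p α γ opt) r C ω t).mem.Represents
        (learnerParams n T B p α γ opt) (O (learnerParams n T B p α γ opt).scale)
        (learnerState (learnerParams n T B p α γ opt)
          (O (learnerParams n T B p α γ opt).scale) r C ω t) ∧
      (play knapsackAlg O (initMem n d T B p α γ opt) r C ω t).cost
        = (learnerState (learnerParams n T B p α γ opt)
          (O (learnerParams n T B p α γ opt).scale) r C ω t).load ∧
      (play knapsackAlg O (initMem n d T B p α γ opt) r C ω t).reward
        = (learnerState (learnerParams n T B p α γ opt)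
          (O (learnerParams n T B p α γ opt).scale) r C ω t).gain ∧
      (play knapsackAlg O (initMem n d T B p α γ opt) r C ω t).time
        ≤ 100 + t * (100 * (n + d + 1)) := by
  set P := learnerParams n T B p α γ opt with hP
  intro t
  induction t with
  | zero =>
    intro _
    refine ⟨setupProg_represents d T O B p α γ opt _, rfl, rfl, ?_⟩
    have h := Prog.time_le_timeBound (O := O) (n := n) setupProg rfl
      (initMem n d T B p α γ opt) rfl rfl
    simpa [play, knapsackAlg] using h.trans (setupProg_timeBound n d)
  | succ t ih =>
    intro ht
    obtain ⟨hrep, hcost, hrew, htime⟩ := ih (by omega)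
    set s := play knapsackAlg O (initMem n d T B p α γ opt) r C ω t with hs
    set st := learnerState P (O P.scale) r C ω t with hst
    have hrnd := hround t (by omega)
    have h3 := (run_roundProg hrep (ω t)).2.1
    have ha : chosenAction n (roundProg.run O (s.mem.setReal 1 0 (ω t)))
        = actionOf n (nextAction P st (ω t)) := by
      rw [← h3]; rfl
    have hplay : play knapsackAlg O (initMem n d T B p α γ opt) r C ω (t + 1)
        = { mem := ((roundProg.run O (s.mem.setReal 1 0 (ω t))).setReal 1 1
              (r t (actionOf n (nextAction P st (ω t))))).setVec 2
                fun j => C t j (actionOf n (nextAction P st (ω t)))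
            time := s.time + (roundProg.exec O (s.mem.setReal 1 0 (ω t))).2
            cost := s.cost + fun j => C t j (actionOf n (nextAction P st (ω t)))
            reward := s.reward + r t (actionOf n (nextAction P st (ω t))) } := by
      rw [play, ← hs, playRound]
      simp only [knapsackAlg]
      rw [← ha]
      rfl
    rw [hplay, learnerState, ← hst]
    refine ⟨represents_round hrep _ hrnd, ?_, ?_, ?_⟩
    · by_cases hact : st.spent ≤ P.threshold
      · rw [nextState_of_le hact, hcost]
      · rw [nextState_of_lt hact, hcost, nextAction, if_neg hact, actionOf_zero]
        ext j
        simp [hrnd.null_cost]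
    · by_cases hact : st.spent ≤ P.threshold
      · rw [nextState_of_le hact, hrew]
      · rw [nextState_of_lt hact, hrew, nextAction, if_neg hact, actionOf_zero,
          hrnd.null_reward, add_zero]
    · have h := Prog.time_le_timeBound (O := O) (n := n) roundProg rfl
        (s.mem.setReal 1 0 (ω t)) hrep.ready.nat_zero hrep.ready.nat_one
      have h' := h.trans (roundProg_timeBound n d)
      dsimp only
      rw [Nat.succ_mul]
      omega

end Execution

/-! ### The guarantee -/

theorem optBwK_nonneg {n d T : ℕ} [NeZero n] {N : Seminorm ℝ (Fin d → ℝ)} {B : ℝ}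
    {r : ℕ → Fin n → ℝ} {C : ℕ → Matrix (Fin d) (Fin n) ℝ}
    (hround : ∀ t < T, IsRound (r t) (C t)) : 0 ≤ optBwK N B T r C := by
  refine Real.sSup_nonneg ?_
  rintro v ⟨x, hx, _, _, rfl⟩
  exact Finset.sum_nonneg fun t ht => Finset.sum_nonneg fun i _ =>
    mul_nonneg ((hround t (Finset.mem_range.1 ht)).reward_mem i).1 (hx i)

theorem optBwK_le {n d T : ℕ} [NeZero n] {N : Seminorm ℝ (Fin d → ℝ)} {B : ℝ}
    {r : ℕ → Fin n → ℝ} {C : ℕ → Matrix (Fin d) (Fin n) ℝ}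
    (hround : ∀ t < T, IsRound (r t) (C t)) : optBwK N B T r C ≤ T := by
  refine Real.sSup_le ?_ (Nat.cast_nonneg T)
  rintro v ⟨x, hx, hx1, _, rfl⟩
  calc ∑ t ∈ Finset.range T, ∑ i, r t i * x i ≤ ∑ _t ∈ Finset.range T, (1 : ℝ) := by
        refine Finset.sum_le_sum fun t ht => le_trans (Finset.sum_le_sum fun i _ => ?_) hx1
        exact mul_le_of_le_one_left (hx i) ((hround t (Finset.mem_range.1 ht)).reward_mem i).2
    _ = T := by simp

/-- With the null action as the only action the benchmark is `0`. -/
theorem two_le_of_optBwK_pos {n d T : ℕ} [NeZero n] {N : Seminorm ℝ (Fin d → ℝ)} {B : ℝ}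
    {r : ℕ → Fin n → ℝ} {C : ℕ → Matrix (Fin d) (Fin n) ℝ}
    (hround : ∀ t < T, IsRound (r t) (C t)) (hpos : 0 < optBwK N B T r C) : 2 ≤ n := by
  by_contra hn
  have h1 : n = 1 := by have := NeZero.pos n; omega
  subst h1
  refine absurd hpos (not_lt.2 (Real.sSup_le ?_ le_rfl))
  rintro v ⟨x, _, _, _, rfl⟩
  refine Finset.sum_nonpos fun t ht => Finset.sum_nonpos fun i _ => ?_
  rw [Subsingleton.elim i 0, (hround t (Finset.mem_range.1 ht)).null_reward, zero_mul]

/-- A positive reward bound puts the instance into the regime of large benchmark and budget. -/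
theorem largeRegime_of_bound_pos {n d T : ℕ} [NeZero n] {N : Seminorm ℝ (Fin d → ℝ)}
    {B p A : ℝ} {r : ℕ → Fin n → ℝ} {C : ℕ → Matrix (Fin d) (Fin n) ℝ}
    (hround : ∀ t < T, IsRound (r t) (C t)) (hA : 1 ≤ A) (hN : 0 < N 1) (hB : 0 < B)
    (hp : 0 < p) (hp1 : p ≤ 1)
    (hpos : 0 < 1 / 100000 * (optBwK N B T r C / A)
      - 1 * (1 + optBwK N B T r C * N 1 / (A * B)) * √(T * n * Real.log (n / p))) :
    LargeRegime n T A (Real.log (n / p)) √(T * n * Real.log (n / p)) (N 1) B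
      (optBwK N B T r C) := by
  have hopt0 : 0 ≤ optBwK N B T r C := optBwK_nonneg hround
  have hoptT : optBwK N B T r C ≤ T := optBwK_le hround
  have htwo := two_le_of_optBwK_pos (N := N) (B := B) hround
  set opt := optBwK N B T r C
  set S := √(T * n * Real.log (n / p)) with hS
  have hA0 : 0 < A := by linarith
  have hS0 : 0 ≤ S := Real.sqrt_nonneg _
  have hfrac : 0 ≤ opt * N 1 / (A * B) := by positivity
  have hfracS : 0 ≤ opt * N 1 / (A * B) * S := mul_nonneg hfrac hS0
  have ho : 0 < opt / A := by nlinarith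
  have hopt : 0 < opt := by
    rcases hopt0.lt_or_eq with h | h
    · exact h
    · rw [← h, zero_div] at ho; exact absurd ho (lt_irrefl 0)
  have hn2 : (2 : ℝ) ≤ n := by exact_mod_cast htwo hopt
  have hL : 69 / 100 ≤ Real.log (n / p) := by
    have h1 : Real.log 2 ≤ Real.log (n / p) := by
      refine Real.log_le_log (by norm_num) ?_
      rw [le_div_iff₀ hp]
      nlinarith
    linarith [Real.log_two_gt_d9]
  refine ⟨hA, by linarith, by nlinarith, hS0, ?_, hN, hoptT, ?_, ?_⟩
  · rw [hS, Real.sq_sqrt]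
    · ring
    · have : 0 ≤ Real.log (n / p) := by linarith
      positivity
  · have h1 : 100000 * S < opt / A := by nlinarith
    rw [lt_div_iff₀ hA0] at h1
    linarith
  · have h1 : opt * N 1 / (A * B) * S < 1 / 100000 * (opt / A) := by nlinarith
    have h2 : opt * N 1 / (A * B) * S = opt / A * (N 1 * S / B) := by field_simp
    rw [h2, mul_comm (1 / 100000 : ℝ)] at h1
    have h3 := lt_of_mul_lt_mul_left h1 ho.le
    rw [div_lt_iff₀ hB] at h3
    linarith

end

theorem mainTheorem4 :
    ∃ (A : BanditAlg) (c K : ℝ) (M k : ℕ), 0 < c ∧ 0 < K ∧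
      ∀ (n d T : ℕ) [NeZero n], 0 < d →
      -- a monotone norm on `ℝ^d`
      ∀ N : Seminorm ℝ (Fin d → ℝ), (∀ x, N x = 0 → x = 0) →
      (∀ u v : Fin d → ℝ, 0 ≤ v → v ≤ u → N v ≤ N u) →
      -- a gradient-stable approximation of it, at all scales
      ∀ (α γ : ℝ) (Ψ : ℝ → (Fin d → ℝ) → ℝ),
      (∀ ε > 0, IsGradStableApprox N (1 / 4) α γ ε (Ψ ε)) →
      ∀ B p : ℝ, 4 * (α + γ) * N 1 ≤ B → 0 < p → p ≤ 1 →
      -- adversarial rewards and costs, with the null action `0`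
      ∀ (r : ℕ → Fin n → ℝ) (C : ℕ → Matrix (Fin d) (Fin n) ℝ),
      (∀ t < T, ∀ i, r t i ∈ Set.Icc (0 : ℝ) 1) →
      (∀ t < T, ∀ j i, C t j i ∈ Set.Icc (0 : ℝ) 1) →
      (∀ t < T, r t 0 = 0 ∧ ∀ j, C t j 0 = 0) →
      ∀ opt : ℝ, opt = optBwK N B T r C →
      ∀ final : (ℕ → unitInterval) → PlayState d,
      (∀ ω, final ω =
        play A (fun ε => orthantGrad (Ψ ε)) (initMem n d T B p α γ opt) r C ω T) →
      -- the budget is always respected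
      (∀ ω, N (final ω).cost < B) ∧
      -- the total running time is polynomial
      (∀ ω, (final ω).time ≤ M * (n + d + T) ^ k) ∧
      -- the reward bound fails with probability at most `p`
      seedMeasure {ω | (final ω).reward <
          c * (opt / (α + γ)) -
            K * (1 + opt * N 1 / ((α + γ) * B)) * Real.sqrt (T * n * Real.log (n / p))}
        ≤ ENNReal.ofReal p := by
  refine ⟨knapsackAlg, 1 / 100000, 1, 300, 2, by norm_num, by norm_num, ?_⟩
  intro n d T _ hd N hN0 hmono α γ Ψ hΨ B p hB hp hp1 r C hr hC hnull opt hopt final hfinal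
  have hround : ∀ t < T, IsRound (r t) (C t) := fun t ht =>
    ⟨hr t ht, hC t ht, (hnull t ht).1, (hnull t ht).2⟩
  have hN1 : 0 < N 1 := by
    refine lt_of_le_of_ne (apply_nonneg N 1) fun h => ?_
    have := congrFun (hN0 1 h.symm) ⟨0, hd⟩
    simp at this
  have hα : 1 ≤ α := one_le_of_isGradStableApprox hΨ hN1
  have hγ : 0 ≤ γ := (hΨ 1 one_pos).additive_nonneg one_pos
  have hA : 1 ≤ α + γ := by linarith
  have hNB : 4 * N 1 ≤ B := by nlinarith
  have hBpos : 0 < B := by linarith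
  set P := learnerParams n T B p α γ opt with hP
  have hε : 0 < P.scale := by simp only [hP, learnerParams]; positivity
  have hΨε := hΨ P.scale hε
  have hplay : ∀ ω, (final ω).cost = (learnerState P (orthantGrad (Ψ P.scale)) r C ω T).load ∧
      (final ω).reward = (learnerState P (orthantGrad (Ψ P.scale)) r C ω T).gain ∧
      (final ω).time ≤ 100 + T * (100 * (n + d + 1)) := fun ω => by
    rw [hfinal ω]
    exact (play_knapsackAlg (O := fun ε => orthantGrad (Ψ ε)) hround ω T le_rfl).2
  refine ⟨fun ω => ?_, fun ω => ?_, ?_⟩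
  · have hsum : γ / P.scale + P.threshold = B / 2 := by
      simp only [hP, learnerParams]; ring
    have := (potential_le_spent (ω := ω) (P := P) hΨε hmono hround
      (by rw [hsum]; linarith) T le_rfl).2.2
    rw [(hplay ω).1]
    linarith
  · refine (hplay ω).2.2.trans ?_
    have hn := NeZero.pos n
    have h1 : 1 ≤ (n + d + T) ^ 2 := Nat.one_le_pow _ _ (by omega)
    have h2 : T * (n + d + 1) ≤ 2 * (n + d + T) ^ 2 := by
      rw [sq]
      calc T * (n + d + 1) ≤ (n + d + T) * (2 * (n + d + T)) :=
            Nat.mul_le_mul (by omega) (by omega)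
        _ = 2 * ((n + d + T) * (n + d + T)) := by ring
    calc 100 + T * (100 * (n + d + 1)) = 100 * 1 + 100 * (T * (n + d + 1)) := by ring
      _ ≤ 100 * (n + d + T) ^ 2 + 100 * (2 * (n + d + T) ^ 2) := by gcongr
      _ = 300 * (n + d + T) ^ 2 := by ring
  · by_cases hpos : 0 < 1 / 100000 * (opt / (α + γ))
        - 1 * (1 + opt * N 1 / ((α + γ) * B)) * √(T * n * Real.log (n / p))
    swap
    · -- rewards are non-negative
      have hempty : {ω | (final ω).reward < 1 / 100000 * (opt / (α + γ))
          - 1 * (1 + opt * N 1 / ((α + γ) * B)) * √(T * n * Real.log (n / p))} = ∅ := by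
        ext ω
        simp only [Set.mem_ofPred_eq, Set.mem_empty_iff_false, iff_false, not_lt]
        have := gain_nonneg (P := P) (G := orthantGrad (Ψ P.scale)) (ω := ω) hround T le_rfl
        rw [(hplay ω).2.1]
        linarith
      rw [hempty, measure_empty]
      exact bot_le
    have hreg : LargeRegime n T (α + γ) (Real.log (n / p)) √(T * n * Real.log (n / p)) (N 1) B
        opt := by
      rw [hopt] at hpos ⊢
      exact largeRegime_of_bound_pos hround hA hN1 hBpos hp hp1 hpos
    have hoptpos := hreg.opt_pos
    obtain ⟨v, ⟨x, hx, hx1, hxB, hv⟩, hlt⟩ : ∃ v ∈ {v : ℝ | ∃ x : Fin n → ℝ, (∀ i, 0 ≤ x i) ∧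
        ∑ i, x i ≤ 1 ∧ N (∑ t ∈ Finset.range T, (C t).mulVec x) ≤ B ∧
        v = ∑ t ∈ Finset.range T, ∑ i, r t i * x i}, opt / 2 < v := by
      refine exists_lt_of_lt_csSup ⟨0, 0, fun _ => le_rfl, by simp, ?_, by simp⟩ ?_
      · simp [hBpos.le]
      · change opt / 2 < optBwK N B T r C
        rw [← hopt]
        linarith
    refine le_trans (measure_mono fun ω hω => ?_) (seedMeasure_shortfall_le (P := P) hΨε
      (by linarith) hmono hround (hreg.admissible hα hγ) hp)
    rw [Set.mem_ofPred_eq] at hω ⊢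
    by_contra hcon
    push Not at hcon
    have hge := gain_ge (ω := ω) hα hγ hreg hΨε hmono hround hp hp1 hcon hx hx1 hxB
      (hlt.le.trans hv.le)
    rw [(hplay ω).2.1] at hω
    have hS : 0 ≤ 1 * (1 + opt * N 1 / ((α + γ) * B)) * √(T * n * Real.log (n / p)) := by
      have : 0 ≤ opt * N 1 / ((α + γ) * B) := by positivity
      have := Real.sqrt_nonneg (T * n * Real.log (n / p))
      positivity
    linarith
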